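/- Consider the $L$-by-$L$ square lattice $\Lambda$ with open boundary conditions, with a Hilbert space $\mathbb{C}^D$ ($D\ge 1$) on each site, and a Hamiltonian $H=\sum_Z Q_Z$, where $Z$ runs over the plaquettes (the sets of four sites around a unit square), each $Q_Z$ is a Hermitian projector supported on $Z$, and $[Q_Y,Q_Z]=0$ for all $Y,Z$. For an algebra $\mathcal A$ of operators and a set of sites $X$, the interaction algebra of $\mathcal A$ on $X$ is the algebra of operators on $X$ generated by all partial traces $\mathrm{tr}_{\overline X}(O K)$ with $O\in\mathcal A$ and $K$ supported on the complement $\overline X$. A set of holes is a family of pairwise disjoint sets of sites $S_i$, each containing the four sites of some plaquette. The boundary $B_i$ of $S_i$ is the set of sites of $S_i$ that belong to a plaquette $Z\not\subset S_i$. Let $\mathcal A_i^I$ (respectively $\mathcal A_i^E$) be the interaction algebra on $B_i$ of the algebra generated by the $Q_Z$ with $Z\subset S_i$ (respectively $Z\not\subset S_i$). The holes form a square lattice of size at most $C$ if their centers are the points of a finite axis-parallel square grid of spacing $r$ with $0<r\le C$, each hole has diameter at most $C$ and lies within distance $C$ of its center, and the grid extends over the whole system, i.e. every site is within distance $C$ of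 some center. Theorem. For every $C$ there are a depth $k$ and a range $R$, depending only on $C$, such that the following holds for all $L$, $D$ and $H$ as above and every set of holes that forms a square lattice of size at most $C$. Suppose that for every $i$ the Hilbert space of $B_i$ factors as $\mathcal H_{B_i}=\mathcal H_{B_i\to E_i}\otimes\mathcal H_{B_i\to I_i}$ so that $\mathcal A_i^E$ acts only on $\mathcal H_{B_i\to E_i}$ and $\mathcal A_i^I$ acts only on $\mathcal H_{B_i\to I_i}$. Then $H$ has a trivial ground state when ancillas are allowed: adjoining to each site an ancilla space $\mathbb{C}^D$, there is a ground state (a unit vector of least energy) $\psi$ of $H\otimes I$ of the form $\psi=U\phi$, where $\phi$ is a product state and $U$ is a quantum circuit of depth at most $k$, each of whose layers is a product of unitaries supported on pairwise disjoint sets of sites of diameter at most $R$ (each acting on the system and ancilla degrees of freedom of its sites). In particular, if $H$ has a zero-energy ground state, then $\psi$ is a zero-energy ground state of $H\otimes I$. -/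

import Mathlib

open scoped Matrix Kronecker

noncomputable section

/-! ## Many-site quantum systems

`V` is the finite set of sites and `α` labels an orthonormal basis of the Hilbert space of one site.
The Hilbert space of a set of sites `X` is the space of functions `(X → α) → ℂ`. -/

/-- Operators on the Hilbert space of the sites `V`, as matrices in the product basis. -/
abbrev Op (V α : Type*) := Matrix (V → α) (V → α) ℂ

section General

variable {V α : Type*} [Fintype V] [DecidableEq V] [Fintype α] [DecidableEq α]

/-- `M` on the sites of `X`, tensored with the identity on all the other sites. -/
def extendOp (X : Finset V) (M : Op X α) : Op V α := fun σ τ =>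
  if ∀ v, v ∉ X → σ v = τ v then M (fun x => σ x) (fun x => τ x) else 0

/-- The operator `O` is supported on the set of sites `X`. -/
def SupportedOn (X : Finset V) (O : Op V α) : Prop :=
  ∃ M : Op X α, O = extendOp X M

/-- The basis configuration that is `x` on `X` and `y` on the complement of `X`. -/
def glue (X : Finset V) (x : X → α) (y : (Xᶜ : Finset V) → α) : V → α := fun v =>
  if h : v ∈ X then x ⟨v, h⟩ else y ⟨v, Finset.mem_compl.2 h⟩

/-- Partial trace over all the sites outside `X`. -/
def partialTrace (X : Finset V) (O : Op V α) : Op X α := fun x x' =>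
  ∑ y : (Xᶜ : Finset V) → α, O (glue X x y) (glue X x' y)

/-- The interaction algebra on `X` of the algebra `A`: it is generated by all partial traces
`tr_{Xᶜ} (O K)` with `O` in `A` and `K` supported on the complement of `X`. -/
def interactionAlgebra (A : Subalgebra ℂ (Op V α)) (X : Finset V) : Subalgebra ℂ (Op X α) :=
  Algebra.adjoin ℂ {M | ∃ O ∈ A, ∃ K : Op (Xᶜ : Finset V) α,
    M = partialTrace X (O * extendOp Xᶜ K)}

end General

/-- A unit vector of least energy `⟨ψ, H ψ⟩` among all unit vectors. -/
def IsGroundState {κ : Type*} [Fintype κ] (H : Matrix κ κ ℂ) (ψ : κ → ℂ) : Prop :=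
  star ψ ⬝ᵥ ψ = 1 ∧
    ∀ φ : κ → ℂ, star φ ⬝ᵥ φ = 1 → (star ψ ⬝ᵥ (H *ᵥ ψ)).re ≤ (star φ ⬝ᵥ (H *ᵥ φ)).re

/-! ## The square lattice and the Hamiltonian -/

/-- Sites of the `L`-by-`L` lattice. -/
abbrev Site (L : ℕ) := Fin L × Fin L

/-- Plaquettes of the lattice, labelled by the coordinates of their lower left corner. -/
abbrev Plaquette (L : ℕ) := Fin (L - 1) × Fin (L - 1)

/-- The four sites around a plaquette. -/
def Plaquette.sites {L : ℕ} (Z : Plaquette L) : Finset (Site L) :=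
  Finset.univ.filter fun s =>
    (s.1.val = Z.1.val ∨ s.1.val = Z.1.val + 1) ∧ (s.2.val = Z.2.val ∨ s.2.val = Z.2.val + 1)

/-- The position of a site in the plane. Distances in `ℝ × ℝ` are those of the maximum norm. -/
def Site.pos {L : ℕ} (s : Site L) : ℝ × ℝ := ((s.1.val : ℝ), (s.2.val : ℝ))

/-- Commuting Hermitian projectors `Q_Z`, one for each plaquette `Z` and supported on it. -/
structure IsCommutingProjectors {L D : ℕ} (Q : Plaquette L → Op (Site L) (Fin D)) : Prop where
  supported : ∀ Z, SupportedOn (Plaquette.sites Z) (Q Z)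
  hermitian : ∀ Z, (Q Z).IsHermitian
  idempotent : ∀ Z, Q Z * Q Z = Q Z
  commute : ∀ Y Z, Q Y * Q Z = Q Z * Q Y

/-- The Hamiltonian `H = ∑_Z Q_Z`. -/
def hamiltonian {L D : ℕ} (Q : Plaquette L → Op (Site L) (Fin D)) : Op (Site L) (Fin D) :=
  ∑ Z, Q Z

/-! ## Holes -/

/-- The boundary of a set of sites `S`: the sites of `S` that belong to a plaquette which is not
contained in `S`. -/
def siteBoundary {L : ℕ} (S : Finset (Site L)) : Finset (Site L) :=
  S.filter fun s => ∃ Z : Plaquette L, s ∈ Plaquette.sites Z ∧ ¬ Plaquette.sites Z ⊆ S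

/-- The interior interaction algebra: the interaction algebra on the boundary of `S` of the algebra
generated by the `Q_Z` with `Z ⊆ S`. -/
def interiorAlgebra {L D : ℕ} (Q : Plaquette L → Op (Site L) (Fin D)) (S : Finset (Site L)) :
    Subalgebra ℂ (Op (siteBoundary S) (Fin D)) :=
  interactionAlgebra (Algebra.adjoin ℂ {O | ∃ Z, Plaquette.sites Z ⊆ S ∧ O = Q Z}) (siteBoundary S)

/-- The exterior interaction algebra: the interaction algebra on the boundary of `S` of the algebra
generated by the `Q_Z` with `Z ⊄ S`. -/
def exteriorAlgebra {L D : ℕ} (Q : Plaquette L → Op (Site L) (Fin D)) (S : Finset (Site L)) :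
    Subalgebra ℂ (Op (siteBoundary S) (Fin D)) :=
  interactionAlgebra (Algebra.adjoin ℂ {O | ∃ Z, ¬ Plaquette.sites Z ⊆ S ∧ O = Q Z})
    (siteBoundary S)

/-- The Hilbert space of the boundary `B` of `S` factors, through some unitary `u`, as
`ℂᵃ ⊗ ℂᵇ`, where the exterior interaction algebra acts only on the first factor and the interior
interaction algebra acts only on the second factor. -/
def BoundaryFactors {L D : ℕ} (Q : Plaquette L → Op (Site L) (Fin D)) (S : Finset (Site L)) :
    Prop :=
  ∃ (a b : ℕ) (u : Matrix (Fin a × Fin b) (siteBoundary S → Fin D) ℂ),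
    u * uᴴ = 1 ∧ uᴴ * u = 1 ∧
    (∀ x ∈ exteriorAlgebra Q S, ∃ y : Matrix (Fin a) (Fin a) ℂ,
      u * x * uᴴ = y ⊗ₖ (1 : Matrix (Fin b) (Fin b) ℂ)) ∧
    (∀ x ∈ interiorAlgebra Q S, ∃ y : Matrix (Fin b) (Fin b) ℂ,
      u * x * uᴴ = (1 : Matrix (Fin a) (Fin a) ℂ) ⊗ₖ y)

/-- A set of holes: pairwise disjoint sets of sites, each of which contains the four sites of some
plaquette. -/
structure IsHoles {L : ℕ} {ι : Type*} (S : ι → Finset (Site L)) : Prop where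
  plaquette : ∀ i, ∃ Z : Plaquette L, Plaquette.sites Z ⊆ S i
  disjoint : ∀ i j, i ≠ j → Disjoint (S i) (S j)

/-- The holes form a square lattice of size at most `C`: their centers are the points of an
`m`-by-`n` square grid of spacing `r ≤ C`, each hole has diameter at most `C` and lies around
its center, and the grid of holes extends over the whole system, so that no site is farther than `C`
from all the centers. -/
def FormSquareLattice {L m n : ℕ} (C : ℕ) (S : Fin m × Fin n → Finset (Site L)) : Prop :=
  ∃ (c : Fin m × Fin n → ℝ × ℝ) (o : ℝ × ℝ) (r : ℝ),
    0 < r ∧ r ≤ C ∧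
    (∀ i, c i = (o.1 + r * (i.1.val : ℝ), o.2 + r * (i.2.val : ℝ))) ∧
    (∀ i, ∀ s ∈ S i, ∀ t ∈ S i, dist (Site.pos s) (Site.pos t) ≤ C) ∧
    (∀ i, ∀ s ∈ S i, dist (Site.pos s) (c i) ≤ C) ∧
    (∀ s : Site L, ∃ i, dist (Site.pos s) (c i) ≤ C)

/-! ## Ancillas, circuits, and trivial states

With ancillas, the Hilbert space of a site has the basis `Fin D × Fin D`: the first entry is the
real copy and the second entry is the ancilla copy. -/

/-- `H ⊗ I`: the operator `H` on the real copy and the identity on the ancilla copy. -/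
def withAncilla {L D : ℕ} (H : Op (Site L) (Fin D)) : Op (Site L) (Fin D × Fin D) := fun σ τ =>
  if ∀ s, (σ s).2 = (τ s).2 then H (fun s => (σ s).1) (fun s => (τ s).1) else 0

/-- One layer of a circuit of range `R`: a product of unitary gates, supported on pairwise disjoint
sets of sites of diameter at most `R`. -/
def IsLayer {L : ℕ} {α : Type*} [Fintype α] [DecidableEq α] (R : ℕ) (U : Op (Site L) α) : Prop :=
  ∃ gates : List (Finset (Site L) × Op (Site L) α),
    (∀ g ∈ gates, SupportedOn g.1 g.2 ∧ g.2 ∈ Matrix.unitaryGroup (Site L → α) ℂ ∧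
      ∀ s ∈ g.1, ∀ t ∈ g.1, dist (Site.pos s) (Site.pos t) ≤ R) ∧
    gates.Pairwise (fun g g' => Disjoint g.1 g'.1) ∧
    U = (gates.map Prod.snd).prod

/-- A local quantum circuit of depth at most `depth` and range at most `range`. -/
def IsLocalCircuit {L : ℕ} {α : Type*} [Fintype α] [DecidableEq α] (depth range : ℕ)
    (U : Op (Site L) α) : Prop :=
  ∃ layers : List (Op (Site L) α),
    layers.length ≤ depth ∧ (∀ W ∈ layers, IsLayer range W) ∧ U = layers.prod

/-- A normalized product state of all the real and all the ancilla degrees of freedom. -/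
def IsProductState {L D : ℕ} (φ : (Site L → Fin D × Fin D) → ℂ) : Prop :=
  ∃ p q : Site L → Fin D → ℂ,
    (∀ s, star (p s) ⬝ᵥ p s = 1) ∧ (∀ s, star (q s) ⬝ᵥ q s = 1) ∧
    φ = fun σ => ∏ s, p s (σ s).1 * q s (σ s).2

/-- A state of the system with ancillas that a local quantum circuit of the given depth and range
prepares from a product state. -/
def IsTrivialState {L D : ℕ} (depth range : ℕ) (ψ : (Site L → Fin D × Fin D) → ℂ) : Prop :=
  ∃ (U : Op (Site L) (Fin D × Fin D)) (φ : (Site L → Fin D × Fin D) → ℂ),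
    IsLocalCircuit depth range U ∧ IsProductState φ ∧ ψ = U *ᵥ φ

end

/-! If every term acted on at most two cells of bounded size, the argument of Bravyi and Vyalyi for
two-body commuting Hamiltonians would prepare a ground state in bounded depth. The holes serve to
reach this situation and are refilled afterwards.

A joint eigenvector v of least energy (`IsCommutingProjectors.exists_joint_eigenvector`) replaces
each Q_Z by q_Z, either Q_Z or 1 - Q_Z, with q_Z v = v. A state fixed by all q_Z has the same
eigenvalue as v for every term, so it suffices to prepare such a state.

Keep a sparse subgrid of the holes and set aside the terms inside them. The lattice divides into
cells of bounded size so that every other plaquette meets at most one black and one white cell of a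
chessboard (`exists_cells`). Expand each term in matrix units of its white cell. The components left
on a black cell by terms of different white cells commute (`IsTwoCellFamily.generators_commute`), so
the algebras indexed by pairs (cell, owner of the terms) commute. Choose minimal projections in them
with a common fixed vector k that overlaps v. A product of states of single cells lies in the range
of all of them. For each owner, the product of its minimal projections is minimal in an algebra that
contains the owner's terms, so a unitary of that algebra rotates it into their common range
(`exists_unitary_rotation`). These unitaries commute with each other and with the terms of other
owners, which gives `IsTwoCellFamily.exists_circuit`.

To refill a hole, the factorization of its boundary supplies matrix units F that commute with the
exterior terms and whose corners F_kk r F_kk are scalar for every r generated by the interior terms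
(`exists_hole_units`). Exchanging the F factor with ancillas in a known basis state brings it to
F_kk, from where it is rotated into the common range of the interior terms. No exterior term is
disturbed (`exists_hole_gate`). The pieces are assembled in `exists_trivial_fixed`. -/

open scoped TensorProduct

set_option linter.unusedSectionVars false

noncomputable section

/-! ### Operators supported on a set of sites -/

section Support

variable {V α : Type*} [Fintype V] [DecidableEq V] [Fintype α] [DecidableEq α]

/-- Configurations of all sites as pairs of configurations of `X` and of its complement. -/
def splitEquiv (α : Type*) (X : Finset V) :
    (V → α) ≃ (X → α) × ((Xᶜ : Finset V) → α) where
  toFun σ := (fun x => σ x, fun y => σ y)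
  invFun p := glue X p.1 p.2
  left_inv σ := by
    funext v
    by_cases h : v ∈ X <;> simp [glue, h]
  right_inv p := by
    ext v
    · simp [glue]
    · have := Finset.mem_compl.1 v.2
      simp [glue, this]

lemma extendOp_eq_submatrix (X : Finset V) (M : Op X α) :
    extendOp X M = (M ⊗ₖ (1 : Op (Xᶜ : Finset V) α)).submatrix (splitEquiv α X)
      (splitEquiv α X) := by
  ext σ τ
  simp only [extendOp, Matrix.submatrix_apply, Matrix.kroneckerMap_apply, splitEquiv,
    Equiv.coe_fn_mk, Matrix.one_apply, mul_ite, mul_one, mul_zero]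
  congr 1
  simp [funext_iff]

lemma extendOp_compl_eq_submatrix (X : Finset V) (K : Op (Xᶜ : Finset V) α) :
    extendOp Xᶜ K = ((1 : Op X α) ⊗ₖ K).submatrix (splitEquiv α X) (splitEquiv α X) := by
  ext σ τ
  simp only [extendOp, Matrix.submatrix_apply, Matrix.kroneckerMap_apply, splitEquiv,
    Equiv.coe_fn_mk, Matrix.one_apply, ite_mul, one_mul, zero_mul]
  congr 1
  simp [funext_iff]

/-- `extendOp` as a homomorphism of star algebras. -/
def extendHom (α : Type*) [Fintype α] [DecidableEq α] (X : Finset V) :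
    Op X α →⋆ₐ[ℂ] Op V α where
  toFun := extendOp X
  map_one' := by
    rw [extendOp_eq_submatrix, Matrix.one_kronecker_one, Matrix.submatrix_one_equiv]
  map_mul' M N := by
    rw [extendOp_eq_submatrix, extendOp_eq_submatrix, extendOp_eq_submatrix,
      Matrix.submatrix_mul_equiv, ← Matrix.mul_kronecker_mul, one_mul]
  map_zero' := by
    ext σ τ
    simp [extendOp]
  map_add' M N := by
    ext σ τ
    simp only [extendOp, Matrix.add_apply]
    split_ifs <;> simp
  commutes' c := by
    simp only [Algebra.algebraMap_eq_smul_one]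
    rw [extendOp_eq_submatrix, Matrix.smul_kronecker, Matrix.one_kronecker_one]
    ext σ τ
    simp [Matrix.one_apply]
  map_star' M := by
    ext σ τ
    simp only [extendOp, Matrix.star_apply, eq_comm]
    split_ifs <;> simp

@[simp] lemma extendHom_apply (X : Finset V) (M : Op X α) : extendHom α X M = extendOp X M := rfl

lemma SupportedOn.mul {X : Finset V} {O P : Op V α} (hO : SupportedOn X O)
    (hP : SupportedOn X P) : SupportedOn X (O * P) := by
  obtain ⟨M, rfl⟩ := hO
  obtain ⟨N, rfl⟩ := hP
  exact ⟨M * N, (map_mul (extendHom α X) M N).symm⟩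

lemma SupportedOn.star {X : Finset V} {O : Op V α} (hO : SupportedOn X O) :
    SupportedOn X (star O) := by
  obtain ⟨M, rfl⟩ := hO
  exact ⟨Star.star M, (map_star (extendHom α X) M).symm⟩

/-- The algebra of operators supported on `X`. -/
def supportAlgebra (α : Type*) [Fintype α] [DecidableEq α] (X : Finset V) :
    Subalgebra ℂ (Op V α) :=
  (extendHom α X).toAlgHom.range

lemma mem_supportAlgebra {X : Finset V} {O : Op V α} :
    O ∈ supportAlgebra α X ↔ SupportedOn X O :=
  ⟨fun ⟨M, h⟩ => ⟨M, h.symm⟩, fun ⟨M, h⟩ => ⟨M, h.symm⟩⟩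

/-- The matrix entries of `O` are diagonal in the site `v` and independent of its value. -/
def ActsTriviallyAt (v : V) (O : Op V α) : Prop :=
  (∀ σ τ, σ v ≠ τ v → O σ τ = 0) ∧
    ∀ σ τ c, σ v = τ v → O (Function.update σ v c) (Function.update τ v c) = O σ τ

lemma SupportedOn.actsTriviallyAt {X : Finset V} {O : Op V α} (hO : SupportedOn X O) {v : V}
    (hv : v ∉ X) : ActsTriviallyAt v O := by
  obtain ⟨M, rfl⟩ := hO
  refine ⟨fun σ τ h => ?_, fun σ τ c h => ?_⟩
  · exact if_neg fun h' => h (h' v hv)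
  · have h1 : ∀ (ρ : V → α) (x : X), Function.update ρ v c x = ρ x := fun ρ x =>
      Function.update_of_ne (fun hx : (x : V) = v => hv (hx ▸ x.2)) _ _
    simp only [extendOp, h1]
    congr 1
    refine propext (forall₂_congr fun w _ => ?_)
    by_cases hw : w = v
    · subst hw; simp [h]
    · simp [hw]

/-- This reduces support to a condition on one site at a time, which makes enlarging the support
immediate. -/
lemma supportedOn_of_actsTriviallyAt [Nonempty α] {X : Finset V} {O : Op V α}
    (h : ∀ v, v ∉ X → ActsTriviallyAt v O) : SupportedOn X O := by
  obtain ⟨ρ⟩ : Nonempty (V → α) := inferInstance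
  -- Sites outside `X` are reset to the reference configuration `ρ` one at a time. With all of them
  -- reset, the entry depends on the values on `X` alone.
  have key : ∀ σ τ : V → α, (∀ v, v ∉ X → σ v = τ v) → ∀ T : Finset V, Disjoint T X →
      O (T.piecewise ρ σ) (T.piecewise ρ τ) = O σ τ := by
    intro σ τ hστ T
    induction T using Finset.induction_on with
    | empty => simp
    | insert v T hv ih =>
      intro hT
      rw [Finset.disjoint_insert_left] at hT
      rw [Finset.piecewise_insert, Finset.piecewise_insert, (h v hT.1).2, ih hT.2]
      simp [hv, hστ v hT.1]
  refine ⟨fun x x' => O (glue X x fun y => ρ y) (glue X x' fun y => ρ y), ?_⟩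
  ext σ τ
  simp only [extendOp]
  split_ifs with hστ
  · rw [← key σ τ hστ Xᶜ disjoint_compl_left]
    congr 1 <;>
    · funext v
      by_cases hv : v ∈ X <;> simp [glue, hv, Finset.piecewise]
  · push Not at hστ
    obtain ⟨v, hv, hne⟩ := hστ
    exact (h v hv).1 σ τ hne

lemma SupportedOn.mono [Nonempty α] {X Y : Finset V} (hXY : X ⊆ Y) {O : Op V α}
    (hO : SupportedOn X O) : SupportedOn Y O :=
  supportedOn_of_actsTriviallyAt fun _ hv => hO.actsTriviallyAt fun h => hv (hXY h)

lemma extendOp_commute_compl (X : Finset V) (M : Op X α) (K : Op (Xᶜ : Finset V) α) :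
    Commute (extendOp X M) (extendOp Xᶜ K) := by
  rw [Commute, SemiconjBy, extendOp_eq_submatrix, extendOp_compl_eq_submatrix,
    Matrix.submatrix_mul_equiv, Matrix.submatrix_mul_equiv, ← Matrix.mul_kronecker_mul,
    ← Matrix.mul_kronecker_mul]
  simp

lemma SupportedOn.commute [Nonempty α] {X Y : Finset V} (hXY : Disjoint X Y) {O K : Op V α}
    (hO : SupportedOn X O) (hK : SupportedOn Y K) : Commute O K := by
  obtain ⟨M, rfl⟩ := hO
  obtain ⟨N, rfl⟩ := hK.mono (Y := Xᶜ) fun y hy =>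
    Finset.mem_compl.2 (Finset.disjoint_right.1 hXY hy)
  exact extendOp_commute_compl X M N

/-- The commutant of the full matrix algebra on one tensor factor is the algebra of the other
factor. -/
lemma supportedOn_of_commute_compl [Nonempty α] {X : Finset V} {O : Op V α}
    (h : ∀ K, SupportedOn Xᶜ K → Commute O K) : SupportedOn X O := by
  obtain ⟨ρ⟩ : Nonempty ((Xᶜ : Finset V) → α) := inferInstance
  set e := splitEquiv α X
  have key : ∀ a b a' c, O (e.symm (a, b)) (e.symm (a', c)) =
      if b = c then O (e.symm (a, ρ)) (e.symm (a', ρ)) else 0 := by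
    intro a b a' c
    -- Commuting with |c⟩⟨ρ| on the complement forces the block (b, c) to vanish for b ≠ c and to
    -- equal the block (ρ, ρ) for b = c.
    have h1 := congrFun₂ (h _ ⟨Matrix.single c ρ 1, rfl⟩) (e.symm (a, b)) (e.symm (a', ρ))
    rw [extendOp_compl_eq_submatrix, Matrix.mul_apply, Matrix.mul_apply,
      ← e.symm.sum_comp, ← e.symm.sum_comp, Fintype.sum_prod_type, Fintype.sum_prod_type] at h1
    simpa [e, Matrix.kroneckerMap_apply, Matrix.single_apply, Matrix.one_apply, ite_and,
      eq_comm] using h1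
  refine ⟨Matrix.of fun a a' => O (e.symm (a, ρ)) (e.symm (a', ρ)), ?_⟩
  rw [extendOp_eq_submatrix]
  ext σ τ
  have := key (e σ).1 (e σ).2 (e τ).1 (e τ).2
  simp only [Prod.mk.eta, Equiv.symm_apply_apply] at this
  rw [this]
  simp [Matrix.kroneckerMap_apply, Matrix.one_apply, e]

lemma supportedOn_of_commute_site [Nonempty α] {X : Finset V} {O : Op V α}
    (h : ∀ v, v ∉ X → ∀ K, SupportedOn {v} K → Commute O K) : SupportedOn X O :=
  supportedOn_of_actsTriviallyAt fun v hv =>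
    (supportedOn_of_commute_compl (X := {v}ᶜ) fun K hK =>
      h v hv K (by simpa using hK)).actsTriviallyAt (by simp)

/-- An operator supported on the empty set is a scalar. -/
lemma SupportedOn.eq_smul_one {O : Op V α} (hO : SupportedOn ∅ O) : ∃ c : ℂ, O = c • 1 := by
  obtain ⟨M, rfl⟩ := hO
  have hd : ∀ x : (∅ : Finset V) → α, x = fun v => absurd v.2 (Finset.notMem_empty _) := fun x =>
    funext fun v => absurd v.2 (Finset.notMem_empty _)
  set d : (∅ : Finset V) → α := fun v => absurd v.2 (Finset.notMem_empty _)
  refine ⟨M d d, ?_⟩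
  ext σ τ
  simp only [extendOp, Matrix.smul_apply, Matrix.one_apply, smul_eq_mul, mul_ite, mul_one,
    mul_zero]
  rw [hd (fun x => σ x), hd (fun x => τ x)]
  congr 1
  simp [funext_iff]

/-- The matrix unit `|y⟩⟨y'|` on the sites of `X`. -/
def unitOn (X : Finset V) (y y' : X → α) : Op V α := extendOp X (Matrix.single y y' 1)

lemma unitOn_supportedOn (X : Finset V) (y y' : X → α) : SupportedOn X (unitOn X y y') :=
  ⟨_, rfl⟩

lemma unitOn_mul (X : Finset V) (a b c d : X → α) :
    unitOn X a b * unitOn X c d = if b = c then unitOn X a d else 0 := by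
  simp only [unitOn, ← extendHom_apply, ← map_mul]
  split_ifs with h
  · subst h; simp
  · rw [Matrix.single_mul_single_of_ne _ _ _ _ h, map_zero]

lemma unitOn_star (X : Finset V) (a b : X → α) : star (unitOn X a b) = unitOn X b a := by
  simp only [unitOn, ← extendHom_apply, ← map_star, Matrix.star_eq_conjTranspose,
    Matrix.conjTranspose_single, star_one]

lemma sum_unitOn (X : Finset V) : ∑ y : X → α, unitOn X y y = 1 := by
  simp only [unitOn, ← extendHom_apply, ← map_sum]
  rw [Matrix.sum_single_one, map_one]

lemma SupportedOn.mem_span {X : Finset V} {O : Op V α} (hO : SupportedOn X O) :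
    O ∈ Submodule.span ℂ (Set.range fun p : (X → α) × (X → α) => unitOn X p.1 p.2) := by
  obtain ⟨M, rfl⟩ := hO
  rw [Matrix.matrix_eq_sum_single M, ← extendHom_apply, map_sum]
  refine Submodule.sum_mem _ fun i _ => ?_
  rw [map_sum]
  refine Submodule.sum_mem _ fun j _ => ?_
  have : Matrix.single i j (M i j) = M i j • Matrix.single i j (1 : ℂ) := by simp
  rw [this, map_smul]
  exact Submodule.smul_mem _ _ (Submodule.subset_span ⟨(i, j), rfl⟩)

/-- The component of `O` along the matrix unit `unitOn W y y'`. -/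
def component {κ : Type*} [Fintype κ] {N : Type*} [Fintype N] (E : κ → κ → Matrix N N ℂ)
    (O : Matrix N N ℂ) (y y' : κ) : Matrix N N ℂ :=
  ∑ z, E z y * O * E y' z

end Support

/-! ### Components of an operator along matrix units -/

section Units

variable {κ N : Type*} [Fintype κ] [DecidableEq κ] [Fintype N] [DecidableEq N]

/-- A system of matrix units in a full matrix algebra. -/
structure IsMatrixUnits (E : κ → κ → Matrix N N ℂ) : Prop where
  mul : ∀ a b c d, E a b * E c d = if b = c then E a d else 0
  star_eq : ∀ a b, star (E a b) = E b a
  sum : ∑ a, E a a = 1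

variable {E : κ → κ → Matrix N N ℂ}

/-- Components are sums of products of `O` with matrix units, so they inherit commutation relations.
This carries commutation of terms over to commutation of their components. -/
lemma component_commute_of_commute {O X : Matrix N N ℂ} (hO : Commute O X)
    (hX : ∀ a b, Commute (E a b) X) (y y' : κ) : Commute (component E O y y') X :=
  Commute.sum_left _ _ _ fun _ _ => ((hX _ _).mul_left hO).mul_left (hX _ _)

/-- Multiplying by a matrix unit on either side leaves one summand, and it is the same one. So a
component acts trivially on the tensor factor that the units span. -/
lemma IsMatrixUnits.component_commute (hE : IsMatrixUnits E) (O : Matrix N N ℂ) (y y' a b : κ) :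
    Commute (component E O y y') (E a b) := by
  simp only [Commute, SemiconjBy, component, Finset.sum_mul, Finset.mul_sum]
  simp only [mul_assoc, hE.mul]
  simp only [← mul_assoc, hE.mul]
  simp [ite_mul]

lemma IsMatrixUnits.sum_component (hE : IsMatrixUnits E) (O : Matrix N N ℂ) :
    O = ∑ y, ∑ y', component E O y y' * E y y' := by
  have h : ∀ y y', component E O y y' * E y y' = E y y * O * E y' y' := by
    intro y y'
    simp only [component, Finset.sum_mul, mul_assoc, hE.mul]
    simp
  simp only [h, ← Finset.mul_sum, hE.sum, ← Finset.sum_mul, one_mul, mul_one]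

lemma IsMatrixUnits.component_star (hE : IsMatrixUnits E) (O : Matrix N N ℂ) (y y' : κ) :
    star (component E O y y') = component E (star O) y' y := by
  simp [component, star_sum, hE.star_eq, mul_assoc]

end Units

lemma unitOn_isMatrixUnits {V α : Type*} [Fintype V] [DecidableEq V] [Fintype α] [DecidableEq α]
    (X : Finset V) : IsMatrixUnits (unitOn (α := α) X) :=
  ⟨unitOn_mul X, unitOn_star X, sum_unitOn X⟩

/-! ### Minimal projections and rotations between projections -/

section Projections

variable {N : Type*} [Fintype N] [DecidableEq N]

lemma IsStarProjection.eq_of_rank_le {p q : Matrix N N ℂ} (hq : IsStarProjection q)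
    (hpq : p * q = q) (hqp : q * p = q) (h : p.rank ≤ q.rank) : p = q := by
  have hle : LinearMap.range q.mulVecLin ≤ LinearMap.range p.mulVecLin := by
    rintro _ ⟨y, rfl⟩
    exact ⟨q *ᵥ y, by simp [Matrix.mulVec_mulVec, hpq]⟩
  have heq := Submodule.eq_of_le_of_finrank_le hle h
  have key : ∀ y, p *ᵥ y = q *ᵥ y := by
    intro y
    have : p *ᵥ y ∈ LinearMap.range q.mulVecLin := heq ▸ ⟨y, rfl⟩
    obtain ⟨z, hz⟩ := this
    simp only [Matrix.mulVecLin_apply] at hz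
    have h2 : q *ᵥ (p *ᵥ y) = p *ᵥ y := by
      rw [← hz, Matrix.mulVec_mulVec, hq.isIdempotentElem.eq]
    rw [← h2, Matrix.mulVec_mulVec, hqp]
  exact Matrix.ext_of_mulVec_single fun i => key _

lemma aeval_mem_of_mem (A : Subalgebra ℝ (Matrix N N ℂ)) {x : Matrix N N ℂ} (hx : x ∈ A)
    (P : Polynomial ℝ) : Polynomial.aeval x P ∈ A :=
  Algebra.adjoin_le (by simpa using hx) (Polynomial.aeval_mem_adjoin_singleton ℝ x)

/-- The spectral decomposition of a self-adjoint matrix by polynomials in the matrix. -/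
lemma exists_spectral_polynomials [Nonempty N] {x : Matrix N N ℂ} (hx : IsSelfAdjoint x) :
    ∃ (s : Finset ℝ) (P : ℝ → Polynomial ℝ), ∑ c ∈ s, Polynomial.aeval x (P c) = 1 ∧
      ∀ c ∈ s, IsStarProjection (Polynomial.aeval x (P c)) ∧
        x * Polynomial.aeval x (P c) = (c : ℂ) • Polynomial.aeval x (P c) := by
  have hfin : (spectrum ℝ x).Finite := Matrix.finite_real_spectrum
  set s := hfin.toFinset with hs
  have hmem : ∀ c, c ∈ spectrum ℝ x ↔ c ∈ s := by simp [hs]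
  -- Only values on the finite spectrum matter, so the Lagrange basis polynomials at the eigenvalues
  -- evaluate to the spectral projections.
  have hcongr : ∀ P Q : Polynomial ℝ, (∀ c ∈ s, P.eval c = Q.eval c) →
      Polynomial.aeval x P = Polynomial.aeval x Q := by
    intro P Q h
    rw [← cfc_polynomial P x hx, ← cfc_polynomial Q x hx]
    exact cfc_congr fun c hc => h c ((hmem c).1 hc)
  have hbasis : ∀ c ∈ s, ∀ d ∈ s, (Lagrange.basis s id c).eval d = if c = d then 1 else 0 := by
    intro c hc d hd
    split_ifs with h
    · subst h
      exact Lagrange.eval_basis_self (Function.injective_id.injOn) hc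
    · exact Lagrange.eval_basis_of_ne (v := id) h hd
  refine ⟨s, Lagrange.basis s id, ?_, fun c hc => ⟨⟨?_, ?_⟩, ?_⟩⟩
  · rw [← map_sum, hcongr _ 1, map_one]
    intro d hd
    rw [Polynomial.eval_finsetSum, Finset.sum_congr rfl fun c hc => hbasis c hc d hd]
    simp [hd]
  · rw [IsIdempotentElem, ← map_mul]
    refine hcongr _ _ fun d hd => ?_
    rw [Polynomial.eval_mul, hbasis c hc d hd]
    split_ifs <;> simp
  · rw [← cfc_polynomial _ x hx]
    exact cfc_predicate _ _
  · have h1 : x * Polynomial.aeval x (Lagrange.basis s id c) =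
        Polynomial.aeval x (Polynomial.X * Lagrange.basis s id c) := by simp
    have h2 : (c : ℂ) • Polynomial.aeval x (Lagrange.basis s id c) =
        Polynomial.aeval x (Polynomial.C c * Lagrange.basis s id c) := by
      rw [map_mul, Polynomial.aeval_C, Algebra.algebraMap_eq_smul_one, smul_mul_assoc, one_mul]
      exact Complex.coe_smul _ _
    rw [h1, h2]
    refine hcongr _ _ fun d hd => ?_
    rw [Polynomial.eval_mul, Polynomial.eval_mul, hbasis c hc d hd]
    split_ifs with h <;> simp [h]

/-- A projection `p` such that the corner `p x p` of every `x` in `A` is a multiple of `p`. -/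
structure IsMinimalProjection (A : Subalgebra ℂ (Matrix N N ℂ)) (p : Matrix N N ℂ) : Prop where
  mem : p ∈ A
  proj : IsStarProjection p
  corner : ∀ x ∈ A, ∃ c : ℂ, p * x * p = c • p

/-- A star-closed algebra of matrices has a minimal projection on which a given linear functional
that does not vanish at `1` does not vanish. -/
lemma exists_isMinimalProjection (A : Subalgebra ℂ (Matrix N N ℂ)) (hA : ∀ x ∈ A, star x ∈ A)
    (f : Matrix N N ℂ →ₗ[ℂ] ℂ) (hf : f 1 ≠ 0) : ∃ p, IsMinimalProjection A p ∧ f p ≠ 0 := by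
  have hN : Nonempty N := by
    by_contra h
    rw [not_nonempty_iff] at h
    exact hf (by rw [Subsingleton.elim (1 : Matrix N N ℂ) 0, map_zero])
  -- Least rank is taken only among projections on which `f` does not vanish, yet this already
  -- forces minimality in `A`.
  obtain ⟨p, ⟨hpA, hp, hfp⟩, hmin⟩ := (measure (Matrix.rank (R := ℂ) (m := N) (n := N))).wf.has_min
    {p | p ∈ A ∧ IsStarProjection p ∧ f p ≠ 0} ⟨1, A.one_mem, IsStarProjection.one _, hf⟩
  have hpp := hp.isIdempotentElem.eq
  -- The spectral projections of `x` lie in `A`, commute with `p` and sum to 1. Hence `f` is nonzero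
  -- on `p * q c` for some c, and the least rank of `p` gives `p = p * q c`.
  have hself : ∀ x ∈ A, IsSelfAdjoint x → p * x = x → x * p = x → ∃ c : ℂ, x = c • p := by
    intro x hxA hx hpx hxp
    obtain ⟨s, P, hsum, hP⟩ := exists_spectral_polynomials hx
    set q := fun c => Polynomial.aeval x (P c) with hq
    have hcomm : ∀ c, p * q c = q c * p := fun c =>
      (Subalgebra.mem_centralizer_iff ℝ).1 (aeval_mem_of_mem (Subalgebra.centralizer ℝ {p})
        ((Subalgebra.mem_centralizer_iff ℝ).2 (by simp [hpx, hxp])) (P c)) p rfl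
    have hqA : ∀ c, q c ∈ A := fun c => aeval_mem_of_mem (A.restrictScalars ℝ) hxA (P c)
    obtain ⟨c, hc, hfc⟩ : ∃ c ∈ s, f (p * q c) ≠ 0 := by
      by_contra! h
      apply hfp
      rw [← mul_one p, ← hsum, Finset.mul_sum, map_sum]
      exact Finset.sum_eq_zero h
    have hpq : IsStarProjection (p * q c) := hp.mul (hP c hc).1 (hcomm c)
    have h1 : p * (p * q c) = p * q c := by rw [← mul_assoc, hpp]
    have h2 : p * q c * p = p * q c := by rw [mul_assoc, ← hcomm, h1]
    have h3 : p = p * q c := by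
      refine hpq.eq_of_rank_le h1 h2 (not_lt.1 fun h => ?_)
      exact hmin _ ⟨A.mul_mem hpA (hqA c), hpq, hfc⟩ h
    refine ⟨c, ?_⟩
    calc x = x * (q c * p) := by rw [← hcomm, ← h3, hxp]
      _ = (x * q c) * p := (mul_assoc _ _ _).symm
      _ = (c : ℂ) • (q c * p) := by rw [(hP c hc).2, smul_mul_assoc]
      _ = (c : ℂ) • p := by rw [← hcomm, ← h3]
  refine ⟨p, ⟨hpA, hp, fun x hx => ?_⟩, hfp⟩
  have hsp : star p = p := hp.isSelfAdjoint
  have hcorner : ∀ y ∈ A, IsSelfAdjoint y → ∃ c : ℂ, p * y * p = c • p := by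
    intro y hy hys
    refine hself _ (A.mul_mem (A.mul_mem hpA hy) hpA) ?_ ?_ ?_
    · simp [IsSelfAdjoint, hsp, hys.star_eq, mul_assoc]
    · simp only [← mul_assoc, hpp]
    · simp only [mul_assoc, hpp]
  obtain ⟨c, hc⟩ := hcorner (x + star x) (A.add_mem hx (hA x hx)) (IsSelfAdjoint.add_star_self x)
  obtain ⟨d, hd⟩ := hcorner (Complex.I • (x - star x))
    (A.smul_mem (A.sub_mem hx (hA x hx)) _) (by
      rw [IsSelfAdjoint, star_smul, star_sub, star_star]
      simp [smul_sub, neg_add_eq_sub])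
  -- The two scalars belong to x + x* and i(x - x*), and x is half the first minus i/2 times the
  -- second.
  refine ⟨(1 / 2 : ℂ) * c - (1 / 2 : ℂ) * Complex.I * d, ?_⟩
  have hxe : x = (1 / 2 : ℂ) • (x + star x) -
      ((1 / 2 : ℂ) * Complex.I) • (Complex.I • (x - star x)) := by
    rw [smul_smul, mul_assoc, Complex.I_mul_I]
    module
  conv_lhs => rw [hxe]
  rw [mul_sub, sub_mul, mul_smul_comm, smul_mul_assoc, hc, mul_smul_comm, smul_mul_assoc, hd,
    smul_smul, smul_smul, sub_smul]

/-- Two such traces have a positive quotient. This is what makes the corner scalar in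
`exists_unitary_rotation` positive. -/
lemma exists_trace_star_mul_self_eq {B : Matrix N N ℂ} (h : B ≠ 0) :
    ∃ t : ℝ, 0 < t ∧ (star B * B).trace = t := by
  open scoped ComplexOrder in
  have h1 := (Matrix.posSemidef_conjTranspose_mul_self B).trace_nonneg
  have h2 : (star B * B).trace ≠ 0 := fun h' =>
    h (Matrix.trace_conjTranspose_mul_self_eq_zero_iff.1 h')
  rw [Complex.le_def] at h1
  have h3 : (star B * B).trace = ((star B * B).trace.re : ℝ) :=
    Complex.ext rfl h1.2.symm
  refine ⟨_, lt_of_le_of_ne h1.1 fun h4 => h2 ?_, h3⟩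
  rw [h3]
  exact_mod_cast h4.symm

/-- A unitary in the algebra generated by two projections that rotates one into the other. -/
lemma exists_unitary_rotation (A : Subalgebra ℂ (Matrix N N ℂ)) {p q : Matrix N N ℂ}
    (hp : IsStarProjection p) (hq : IsStarProjection q) (hpA : p ∈ A) (hqA : q ∈ A) {c : ℂ}
    (hc : p * q * p = c • p) (hne : q * p ≠ 0) :
    ∃ U ∈ A, U ∈ Matrix.unitaryGroup N ℂ ∧ q * (U * p) = U * p := by
  have hpp := hp.isIdempotentElem.eq
  have hqq := hq.isIdempotentElem.eq
  have hps : star p = p := hp.isSelfAdjoint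
  have hqs : star q = q := hq.isSelfAdjoint
  have hp0 : p ≠ 0 := fun h => hne (by rw [h, mul_zero])
  -- Take traces in (qp)*(qp) = c p.
  obtain ⟨t, ht, htr⟩ : ∃ t : ℝ, 0 < t ∧ c = t := by
    obtain ⟨a, ha, hta⟩ := exists_trace_star_mul_self_eq hp0
    obtain ⟨b, hb, htb⟩ := exists_trace_star_mul_self_eq hne
    have : star (q * p) * (q * p) = c • p := by
      rw [star_mul, hps, hqs, ← hc, mul_assoc, ← mul_assoc q, hqq, ← mul_assoc]
    rw [hps, hpp] at hta
    rw [this, Matrix.trace_smul, hta, smul_eq_mul] at htb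
    refine ⟨b / a, div_pos hb ha, ?_⟩
    have ha' : (a : ℂ) ≠ 0 := by exact_mod_cast ha.ne'
    rw [Complex.ofReal_div, ← htb]
    field_simp
  subst htr
  have hs0 : 0 < √t := Real.sqrt_pos.2 ht
  set s : ℂ := ((√t : ℝ) : ℂ) with hs
  have hs0' : s ≠ 0 := by simpa [hs] using hs0.ne'
  have hst : s * s = t := by rw [hs, ← Complex.ofReal_mul, Real.mul_self_sqrt ht.le]
  have hss : star s = s := Complex.conj_ofReal _
  -- For s = 1 the reflection used below degenerates, but then (p - qp)*(p - qp) = (1 - c) p = 0, so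
  -- p already lies below q.
  by_cases h1 : s = 1
  · refine ⟨1, A.one_mem, one_mem _, ?_⟩
    have h2 : star (p - q * p) * (p - q * p) = 0 := by
      have : star (p - q * p) * (p - q * p) = p * p - p * q * p - p * q * p + p * (q * q) * p := by
        simp only [star_sub, star_mul, hps, hqs]
        noncomm_ring
      rw [this, hpp, hqq, hc, ← hst, h1]
      simp
    have h3 : p - q * p = 0 := by
      open scoped ComplexOrder in
      exact Matrix.conjTranspose_mul_self_eq_zero.1 h2
    rw [one_mul]
    exact (sub_eq_zero.1 h3).symm
  · have h1' : 1 - s ≠ 0 := sub_ne_zero.2 (Ne.symm h1)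
    -- `v` is a partial isometry from the range of `p` into the range of `q`. Since p v = s p with s
    -- real, the Householder reflection along p - v is a self-adjoint unitary that sends p to v.
    set v := s⁻¹ • (q * p) with hv
    have hvs : star v = s⁻¹ • (p * q) := by
      rw [hv, star_smul, star_mul, hps, hqs, star_inv₀, hss]
    have hpv : p * v = s • p := by
      rw [hv, mul_smul_comm, ← mul_assoc, hc, ← hst, smul_smul]
      congr 1
      field_simp
    have hvp : v * p = v := by rw [hv, smul_mul_assoc, mul_assoc, hpp]
    have hsvp : star v * p = s • p := by
      rw [hvs, smul_mul_assoc, hc, ← hst, smul_smul]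
      congr 1
      field_simp
    have hvv : star v * v = p := by
      rw [hvs, hv, smul_mul_smul_comm]
      have : p * q * (q * p) = p * (q * q) * p := by noncomm_ring
      rw [this, hqq, hc, ← hst, smul_smul]
      rw [show s⁻¹ * s⁻¹ * (s * s) = 1 by field_simp, one_smul]
    set y := p - v with hy
    have hyp : y * p = y := by rw [hy, sub_mul, hpp, hvp]
    have hys : star y = p - star v := by rw [hy, star_sub, hps]
    have hsyp : star y * p = (1 - s) • p := by rw [hys, sub_mul, hpp, hsvp, sub_smul, one_smul]
    have hyy : star y * y = (2 * (1 - s)) • p := by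
      rw [hys, hy, sub_mul, mul_sub, mul_sub, hpp, hpv, hsvp, hvv]
      module
    set U := 1 - (1 - s)⁻¹ • (y * star y) with hU
    have hUs : star U = U := by
      rw [hU, star_sub, star_one, star_smul, star_mul, star_star, star_inv₀, star_sub, star_one,
        hss]
    have hyyyy : y * star y * (y * star y) = (2 * (1 - s)) • (y * star y) := by
      have : y * star y * (y * star y) = y * (star y * y) * star y := by noncomm_ring
      rw [this, hyy, mul_smul_comm, smul_mul_assoc, hyp]
    have hUU : U * U = 1 := by
      simp only [hU, sub_mul, mul_sub, one_mul, mul_one, smul_mul_smul_comm]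
      rw [hyyyy, smul_smul,
        show (1 - s)⁻¹ * (1 - s)⁻¹ * (2 * (1 - s)) = 2 * (1 - s)⁻¹ by field_simp]
      module
    have hUp : U * p = v := by
      rw [hU, sub_mul, one_mul, smul_mul_assoc, mul_assoc, hsyp, mul_smul_comm, hyp, smul_smul,
        inv_mul_cancel₀ h1', one_smul, hy]
      abel
    have hyA : y ∈ A := A.sub_mem hpA (A.smul_mem (A.mul_mem hqA hpA) _)
    have hysA : star y ∈ A := by
      rw [hys, hvs]
      exact A.sub_mem hpA (A.smul_mem (A.mul_mem hpA hqA) _)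
    refine ⟨U, A.sub_mem A.one_mem (A.smul_mem (A.mul_mem hyA hysA) _), ?_, ?_⟩
    · rw [Matrix.mem_unitaryGroup_iff, hUs, hUU]
    · rw [hUp, hv, mul_smul_comm, ← mul_assoc, hqq]

/-- The joint range of commuting projections. -/
lemma exists_joint_projection {τ : Type*} (T : Finset τ) (p : τ → Matrix N N ℂ)
    (hp : ∀ t ∈ T, IsStarProjection (p t)) (hc : ∀ t ∈ T, ∀ t' ∈ T, Commute (p t) (p t')) :
    ∃ q ∈ Algebra.adjoin ℂ {x | ∃ t ∈ T, x = p t}, IsStarProjection q ∧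
      (∀ t ∈ T, p t * q = q) ∧ ∀ k, (∀ t ∈ T, p t *ᵥ k = k) → q *ᵥ k = k := by
  classical
  induction T using Finset.induction_on with
  | empty => exact ⟨1, Subalgebra.one_mem _, IsStarProjection.one _, by simp, by simp⟩
  | insert s T hs ih =>
    obtain ⟨q, hqA, hq, hpq, hk⟩ := ih (fun t ht => hp t (Finset.mem_insert_of_mem ht))
      fun t ht t' ht' => hc t (Finset.mem_insert_of_mem ht) t' (Finset.mem_insert_of_mem ht')
    have hcomm : Commute (p s) q := by
      refine Algebra.commute_of_mem_adjoin_of_forall_mem_commute hqA ?_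
      rintro _ ⟨t, ht, rfl⟩
      exact hc s (Finset.mem_insert_self _ _) t (Finset.mem_insert_of_mem ht)
    have hps := hp s (Finset.mem_insert_self _ _)
    have hsub : Algebra.adjoin ℂ {x | ∃ t ∈ T, x = p t} ≤
        Algebra.adjoin ℂ {x | ∃ t ∈ insert s T, x = p t} :=
      Algebra.adjoin_mono fun x ⟨t, ht, h⟩ => ⟨t, Finset.mem_insert_of_mem ht, h⟩
    refine ⟨p s * q, Subalgebra.mul_mem _ (Algebra.subset_adjoin
      ⟨s, Finset.mem_insert_self _ _, rfl⟩) (hsub hqA), hps.mul hq hcomm, ?_, ?_⟩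
    · intro t ht
      rcases Finset.mem_insert.1 ht with rfl | ht
      · rw [← mul_assoc, hps.isIdempotentElem.eq]
      · rw [hcomm.eq, ← mul_assoc, hpq t ht]
    · intro k hk'
      rw [← Matrix.mulVec_mulVec, hk k fun t ht => hk' t (Finset.mem_insert_of_mem ht),
        hk' s (Finset.mem_insert_self _ _)]

/-- The product of minimal projections of commuting algebras is minimal. -/
lemma IsMinimalProjection.mul_sup {A B : Subalgebra ℂ (Matrix N N ℂ)} {p q : Matrix N N ℂ}
    (hAB : ∀ a ∈ A, ∀ b ∈ B, Commute a b) (hp : IsMinimalProjection A p)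
    (hq : IsMinimalProjection B q) : IsMinimalProjection (A ⊔ B) (p * q) := by
  refine ⟨Subalgebra.mul_mem _ ((le_sup_left : A ≤ A ⊔ B) hp.mem)
    ((le_sup_right : B ≤ A ⊔ B) hq.mem), hp.proj.mul hq.proj (hAB p hp.mem q hq.mem), ?_⟩
  have hcomm : ∀ (a : A) (b : B), Commute (A.val a) (B.val b) := fun a b => hAB a a.2 b b.2
  -- Commuting algebras generate the image of their tensor product, and on simple tensors the corner
  -- by `p * q` splits into the two separate corners.
  have hle : A ⊔ B ≤ (Algebra.TensorProduct.lift A.val B.val hcomm).range :=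
    sup_le (fun a ha => ⟨(⟨a, ha⟩ : A) ⊗ₜ[ℂ] (1 : B), by simp⟩)
      fun b hb => ⟨(1 : A) ⊗ₜ[ℂ] (⟨b, hb⟩ : B), by simp⟩
  intro x hx
  obtain ⟨t, rfl⟩ := hle hx
  clear hx
  induction t using TensorProduct.induction_on with
  | zero => exact ⟨0, by simp⟩
  | tmul a b =>
    obtain ⟨c, hc⟩ := hp.corner a a.2
    obtain ⟨d, hd⟩ := hq.corner b b.2
    refine ⟨c * d, ?_⟩
    have h1 := (hAB a a.2 q hq.mem).eq
    have h2 := (hAB p hp.mem b b.2).eq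
    have h3 := (hAB p hp.mem q hq.mem).eq
    calc p * q * (Algebra.TensorProduct.lift A.val B.val hcomm (a ⊗ₜ[ℂ] b)) * (p * q)
        = p * (q * a) * b * (p * q) := by simp [mul_assoc]
      _ = p * a * q * (b * p) * q := by rw [← h1]; simp only [mul_assoc]
      _ = p * a * (q * p) * b * q := by rw [← h2]; simp only [mul_assoc]
      _ = p * a * p * (q * b * q) := by rw [← h3]; simp only [mul_assoc]
      _ = (c * d) • (p * q) := by rw [hc, hd, smul_mul_smul_comm]
  | add s t hs ht =>
    obtain ⟨c, hc⟩ := hs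
    obtain ⟨d, hd⟩ := ht
    exact ⟨c + d, by rw [map_add, mul_add, add_mul, add_smul, ← hc, ← hd]⟩

/-- Minimal projections of commuting algebras have a joint range, which is minimal for the algebra
they generate. -/
lemma exists_joint_isMinimalProjection {τ : Type*} [DecidableEq τ] (T : Finset τ)
    (A : τ → Subalgebra ℂ (Matrix N N ℂ))
    (hA : ∀ t t', t ≠ t' → ∀ a ∈ A t, ∀ b ∈ A t', Commute a b) (p : τ → Matrix N N ℂ)
    (hp : ∀ t, IsMinimalProjection (A t) (p t)) :
    ∃ q, IsMinimalProjection (T.sup A) q ∧ (∀ t ∈ T, p t * q = q) ∧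
      ∀ k, (∀ t ∈ T, p t *ᵥ k = k) → q *ᵥ k = k := by
  induction T using Finset.induction_on with
  | empty =>
    refine ⟨1, ⟨Subalgebra.one_mem _, IsStarProjection.one _, fun x hx => ?_⟩, by simp, by simp⟩
    obtain ⟨c, rfl⟩ := Algebra.mem_bot.1 (by simpa using hx)
    exact ⟨c, by simp [Algebra.algebraMap_eq_smul_one]⟩
  | insert s T hs ih =>
    obtain ⟨q, hq, hpq, hk⟩ := ih
    have hcomm : ∀ a ∈ A s, ∀ b ∈ T.sup A, Commute a b := by
      intro a ha b hb
      have : T.sup A ≤ Subalgebra.centralizer ℂ {a} := Finset.sup_le fun t ht b hb =>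
        (Subalgebra.mem_centralizer_iff ℂ).2 fun a' ha' => by
          rw [Set.mem_singleton_iff.1 ha']
          exact hA s t (fun h => hs (h ▸ ht)) a ha b hb
      exact (Subalgebra.mem_centralizer_iff ℂ).1 (this hb) a rfl
    refine ⟨p s * q, ?_, ?_, ?_⟩
    · rw [Finset.sup_insert]
      exact (hp s).mul_sup hcomm hq
    · intro t ht
      rcases Finset.mem_insert.1 ht with rfl | ht
      · rw [← mul_assoc, (hp t).proj.isIdempotentElem.eq]
      · rw [(hcomm _ (hp s).mem _ hq.mem).eq, ← mul_assoc, hpq t ht]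
    · intro k hk'
      rw [← Matrix.mulVec_mulVec, hk k fun t ht => hk' t (Finset.mem_insert_of_mem ht),
        hk' s (Finset.mem_insert_self _ _)]

/-- Commuting star-closed algebras have minimal projections with a common fixed vector that is not
orthogonal to a given nonzero vector. -/
lemma exists_isMinimalProjection_family {τ : Type*} [DecidableEq τ] [Fintype τ]
    (A : τ → Subalgebra ℂ (Matrix N N ℂ)) (hs : ∀ t, ∀ x ∈ A t, star x ∈ A t)
    (hA : ∀ t t', t ≠ t' → ∀ a ∈ A t, ∀ b ∈ A t', Commute a b) {v : N → ℂ} (hv : v ≠ 0) :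
    ∃ (p : τ → Matrix N N ℂ) (k : N → ℂ), (∀ t, IsMinimalProjection (A t) (p t)) ∧
      (∀ t, p t *ᵥ k = k) ∧ star k ⬝ᵥ v ≠ 0 := by
  suffices h : ∀ T : Finset τ, ∃ (p : τ → Matrix N N ℂ) (k : N → ℂ),
      (∀ t ∈ T, IsMinimalProjection (A t) (p t)) ∧ (∀ t ∈ T, p t *ᵥ k = k) ∧
      star k ⬝ᵥ v ≠ 0 by
    obtain ⟨p, k, h1, h2, h3⟩ := h Finset.univ
    exact ⟨p, k, fun t => h1 t (Finset.mem_univ t), fun t => h2 t (Finset.mem_univ t), h3⟩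
  intro T
  induction T using Finset.induction_on with
  | empty => exact ⟨fun _ => 0, v, by simp, by simp, by
    open scoped ComplexOrder in simpa using hv⟩
  | insert s T hsT ih =>
    obtain ⟨p, k, h1, h2, h3⟩ := ih
    let f : Matrix N N ℂ →ₗ[ℂ] ℂ :=
      { toFun := fun x => star k ⬝ᵥ (x *ᵥ v)
        map_add' := fun x y => by rw [Matrix.add_mulVec, dotProduct_add]
        map_smul' := fun c x => by rw [Matrix.smul_mulVec, dotProduct_smul]; rfl }
    -- The functional x ↦ ⟨k, x v⟩ is nonzero at 1. A minimal projection on which it is nonzero lets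
    -- `q *ᵥ k` replace `k`: it still overlaps `v`, and the earlier projections fix it because they
    -- commute with `q`.
    obtain ⟨q, hq, hfq⟩ := exists_isMinimalProjection (A s) (hs s) f (by simpa [f] using h3)
    have hne : ∀ t ∈ T, t ≠ s := fun t ht h => hsT (h ▸ ht)
    refine ⟨Function.update p s q, q *ᵥ k, ?_, ?_, ?_⟩
    · intro t ht
      rcases Finset.mem_insert.1 ht with rfl | ht
      · simpa using hq
      · rw [Function.update_of_ne (hne t ht)]
        exact h1 t ht
    · intro t ht
      rcases Finset.mem_insert.1 ht with rfl | ht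
      · rw [Function.update_self, Matrix.mulVec_mulVec, hq.proj.isIdempotentElem.eq]
      · rw [Function.update_of_ne (hne t ht), Matrix.mulVec_mulVec,
          (hA t s (hne t ht) _ (h1 t ht).mem _ hq.mem).eq, ← Matrix.mulVec_mulVec, h2 t ht]
    · rw [Matrix.star_mulVec, ← Matrix.dotProduct_mulVec]
      have : qᴴ = q := hq.proj.isSelfAdjoint
      rw [this]
      exact hfq

end Projections

/-- Moving one chosen factor of a commuting product to the right lets it act first, while whatever
commutes with all other factors passes through the rest. -/
lemma List.exists_prod_map_eq_mul {ι M : Type*} [Monoid M] (f : ι → M)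
    (hf : ∀ i j, i ≠ j → Commute (f i) (f j)) {l : List ι} (hl : l.Nodup) {i : ι} (hi : i ∈ l) :
    ∃ R, (l.map f).prod = R * f i ∧ ∀ x, (∀ j, j ≠ i → Commute x (f j)) → Commute x R := by
  induction l with
  | nil => simp at hi
  | cons a l ih =>
    rw [List.nodup_cons] at hl
    have hne : ∀ j ∈ l, a ≠ j := fun j hj h => hl.1 (h ▸ hj)
    have hcl : ∀ x, (∀ j ∈ l, Commute x (f j)) → Commute x (l.map f).prod := fun x hx =>
      Commute.list_prod_right _ _ fun y hy => by
        obtain ⟨j, hj, rfl⟩ := List.mem_map.1 hy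
        exact hx j hj
    by_cases h : i = a
    · subst h
      refine ⟨(l.map f).prod, ?_, fun x hx => hcl x fun j hj => hx j (hne j hj).symm⟩
      rw [List.map_cons, List.prod_cons]
      exact hcl _ fun j hj => hf _ _ (hne j hj)
    · obtain ⟨R, hR, hc⟩ := ih hl.2 ((List.mem_cons.1 hi).resolve_left h)
      refine ⟨f a * R, by rw [List.map_cons, List.prod_cons, hR, mul_assoc], fun x hx => ?_⟩
      exact (hx a (Ne.symm h)).mul_right (hc x hx)

lemma Subalgebra.commute_of_mem_adjoin {A : Type*} [Ring A] [Algebra ℂ A] {s t : Set A}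
    (h : ∀ x ∈ s, ∀ y ∈ t, Commute x y) {a b : A} (ha : a ∈ Algebra.adjoin ℂ s)
    (hb : b ∈ Algebra.adjoin ℂ t) : Commute a b :=
  Algebra.commute_of_mem_adjoin_of_forall_mem_commute hb fun y hy =>
    (Algebra.commute_of_mem_adjoin_of_forall_mem_commute ha fun x hx => (h x hx y hy).symm).symm

lemma star_mem_adjoin {N : Type*} [Fintype N] [DecidableEq N] {s : Set (Matrix N N ℂ)}
    (hs : ∀ x ∈ s, star x ∈ s) {x : Matrix N N ℂ} (hx : x ∈ Algebra.adjoin ℂ s) :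
    star x ∈ Algebra.adjoin ℂ s := by
  induction hx using Algebra.adjoin_induction with
  | mem x hx => exact Algebra.subset_adjoin (hs x hx)
  | algebraMap c =>
    rw [Algebra.algebraMap_eq_smul_one, star_smul, star_one]
    exact Subalgebra.smul_mem _ (Subalgebra.one_mem _) _
  | add x y _ _ hx hy => rw [star_add]; exact Subalgebra.add_mem _ hx hy
  | mul x y _ _ hx hy => rw [star_mul]; exact Subalgebra.mul_mem _ hy hx

/-! ### Commuting terms that act on two cells -/

section Cells

variable {V α ι ζ : Type*} [Fintype V] [DecidableEq V] [Fintype α] [DecidableEq α]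
  [Fintype ι] [DecidableEq ι] [Fintype ζ]

lemma SupportedOn.commute_of_units [Nonempty α] {X : Finset V} {O K : Op V α}
    (hO : SupportedOn X O) (h : ∀ y y', Commute (unitOn X y y') K) : Commute O K := by
  have h1 : Submodule.span ℂ (Set.range fun p : (X → α) × (X → α) => unitOn X p.1 p.2) ≤
      (Subalgebra.toSubmodule (Subalgebra.centralizer ℂ {K})) := by
    rw [Submodule.span_le]
    rintro _ ⟨p, rfl⟩
    refine (Subalgebra.mem_centralizer_iff ℂ).2 fun x hx => ?_
    rw [Set.mem_singleton_iff.1 hx]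
    exact (h p.1 p.2).symm
  exact ((Subalgebra.mem_centralizer_iff ℂ).1 (h1 hO.mem_span) K rfl).symm

lemma unitOn_isStarProjection (X : Finset V) (y : X → α) : IsStarProjection (unitOn X y y) :=
  ⟨by rw [IsIdempotentElem, unitOn_mul, if_pos rfl], unitOn_star X y y⟩

lemma unitOn_isMinimalProjection (X : Finset V) (y : X → α) :
    IsMinimalProjection (supportAlgebra α X) (unitOn X y y) := by
  refine ⟨mem_supportAlgebra.2 (unitOn_supportedOn _ _ _), unitOn_isStarProjection X y,
    fun x hx => ?_⟩
  obtain ⟨M, rfl⟩ := mem_supportAlgebra.1 hx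
  refine ⟨M y y, ?_⟩
  simp only [unitOn, ← extendHom_apply, ← map_mul, ← map_smul]
  rw [Matrix.single_mul_mul_single]
  simp

lemma unitOn_mulVec_apply (X : Finset V) (σ : V → α) (k : (V → α) → ℂ) :
    (unitOn X (fun x => σ x) (fun x => σ x) *ᵥ k) σ = k σ := by
  rw [Matrix.mulVec, dotProduct, Finset.sum_eq_single σ]
  · simp [unitOn, extendOp]
  · intro τ _ hτ
    have : ∃ v, σ v ≠ τ v := by
      by_contra! h
      exact hτ (funext h).symm
    obtain ⟨v, hv⟩ := this
    by_cases hX : v ∈ X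
    · have : (fun x : X => σ x) ≠ fun x : X => τ x := fun h => hv (congrFun h ⟨v, hX⟩)
      simp [unitOn, extendOp, this]
    · have : ¬ ∀ v, v ∉ X → σ v = τ v := fun h => hv (h v hX)
      simp [unitOn, extendOp, this]
  · simp

lemma unitOn_mulVec_single (X : Finset V) (σ : V → α) :
    unitOn X (fun x => σ x) (fun x => σ x) *ᵥ Pi.single σ 1 = Pi.single σ (1 : ℂ) := by
  ext ρ
  rw [Matrix.mulVec_single_one, Matrix.col_apply]
  by_cases h : ρ = σ
  · subst h
    simp [unitOn, extendOp]
  · rw [Pi.single_eq_of_ne h]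
    have : ∃ v, ρ v ≠ σ v := by
      by_contra! h'
      exact h (funext h')
    obtain ⟨v, hv⟩ := this
    by_cases hX : v ∈ X
    · have : (fun x : X => σ x) ≠ fun x : X => ρ x := fun h => hv (congrFun h ⟨v, hX⟩).symm
      simp [unitOn, extendOp, this]
    · have : ¬ ∀ v, v ∉ X → ρ v = σ v := fun h => hv (h v hX)
      simp [unitOn, extendOp, this]

/-- A unitary on `X` that takes a basis state to a common fixed vector of commuting projections
on `X`. -/
lemma exists_unitary_fixing [Nonempty α] {τ : Type*} [Fintype τ] (X : Finset V) (p : τ → Op V α)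
    (hp : ∀ t, IsStarProjection (p t)) (hpX : ∀ t, SupportedOn X (p t))
    (hpc : ∀ t t', Commute (p t) (p t')) {k : (V → α) → ℂ} (hpk : ∀ t, p t *ᵥ k = k) {σ : V → α}
    (hσ : k σ ≠ 0) :
    ∃ G : Op V α, SupportedOn X G ∧ G ∈ Matrix.unitaryGroup (V → α) ℂ ∧
      ∀ t, p t *ᵥ (G *ᵥ Pi.single σ 1) = G *ᵥ Pi.single σ 1 := by
  obtain ⟨r, hrA, hr, hpr, hrk⟩ := exists_joint_projection Finset.univ p
    (fun t _ => hp t) fun t _ t' _ => hpc t t'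
  have hrM : r ∈ supportAlgebra α X := by
    refine Algebra.adjoin_le ?_ hrA
    rintro _ ⟨t, -, rfl⟩
    exact mem_supportAlgebra.2 (hpX t)
  -- On `X` this is the rank-one projection onto the restriction of `σ`. It overlaps the joint range
  -- `r` because `r` fixes `k` and `k σ ≠ 0`.
  have hE := unitOn_isMinimalProjection X fun x => σ x
  have hEk := unitOn_mulVec_apply X σ k
  have hEσ := unitOn_mulVec_single X σ
  generalize unitOn X (fun x => σ x) (fun x => σ x) = E at hE hEk hEσ
  obtain ⟨c, hc⟩ := hE.corner r hrM
  have hne : r * E ≠ 0 := by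
    intro h0
    have h1 : E * r = 0 := by
      have := congrArg star h0
      rwa [star_mul, hr.isSelfAdjoint.star_eq, hE.proj.isSelfAdjoint.star_eq, star_zero] at this
    apply hσ
    rw [← hEk]
    nth_rw 1 [← hrk k fun t _ => hpk t]
    rw [Matrix.mulVec_mulVec, h1, Matrix.zero_mulVec, Pi.zero_apply]
  obtain ⟨G, hGA, hGU, hrG⟩ := exists_unitary_rotation _ hE.proj hr hE.mem hrM hc hne
  refine ⟨G, mem_supportAlgebra.1 hGA, hGU, fun t => ?_⟩
  have h2 : p t * (G * E) = G * E := by rw [← hrG, ← mul_assoc, hpr t (Finset.mem_univ t)]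
  rw [← hEσ, Matrix.mulVec_mulVec, Matrix.mulVec_mulVec, mul_assoc, h2, Matrix.mulVec_mulVec]

/-- The sites of the cell `i`. -/
def cellSites (cell : V → ι) (i : ι) : Finset V := Finset.univ.filter fun v => cell v = i

lemma mem_cellSites {cell : V → ι} {i : ι} {v : V} : v ∈ cellSites cell i ↔ cell v = i := by
  simp [cellSites]

/-- Commuting projections, each of which acts on at most one black and at most one white cell:
`q Z` acts on the cells `b Z` and `w Z`, which are equal or black and white, respectively. -/
structure IsTwoCellFamily (q : ζ → Op V α) (cell : V → ι) (white : ι → Prop) (b w : ζ → ι) :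
    Prop where
  proj : ∀ Z, IsStarProjection (q Z)
  comm : ∀ Y Z, Commute (q Y) (q Z)
  supp : ∀ Z, SupportedOn (cellSites cell (b Z) ∪ cellSites cell (w Z)) (q Z)
  color : ∀ Z, b Z = w Z ∨ (white (w Z) ∧ ¬ white (b Z))

open Classical in
/-- The sites of the cell `j` if it is white. -/
def whiteSites (cell : V → ι) (white : ι → Prop) (j : ι) : Finset V :=
  if white j then cellSites cell j else ∅

/-- Generators of the algebra on the cell `i` of the terms that belong to the cell `j`. -/
def cellGenerators (q : ζ → Op V α) (cell : V → ι) (white : ι → Prop) (b w : ζ → ι) (t : ι × ι) :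
    Set (Op V α) :=
  {x | ∃ Z, w Z = t.2 ∧ b Z = t.1 ∧ ∃ y y',
    x = component (unitOn (whiteSites cell white t.2)) (q Z) y y'} ∪
  {x | t.1 = t.2 ∧ SupportedOn (whiteSites cell white t.2) x}

/-- The region acted on by the terms that belong to the cell `j`. -/
def cellRegion (cell : V → ι) (b w : ζ → ι) (j : ι) : Finset V :=
  Finset.univ.filter fun v => cell v = j ∨ ∃ Z, w Z = j ∧ cell v = b Z

lemma whiteSites_subset (cell : V → ι) (white : ι → Prop) (j : ι) :
    whiteSites cell white j ⊆ cellSites cell j := by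
  unfold whiteSites
  split_ifs <;> simp

lemma disjoint_cellSites (cell : V → ι) {i j : ι} (h : i ≠ j) :
    Disjoint (cellSites cell i) (cellSites cell j) :=
  Finset.disjoint_left.2 fun _ hv hv' => h ((mem_cellSites.1 hv).symm.trans (mem_cellSites.1 hv'))

namespace IsTwoCellFamily

variable {q : ζ → Op V α} {cell : V → ι} {white : ι → Prop} {b w : ζ → ι}

/-- A term meets no white cell other than its owner: if its cell `b Z` differs from `w Z`, that cell
is black. -/
lemma disjoint_whiteSites (h : IsTwoCellFamily q cell white b w) {Z : ζ} {j : ι} (hj : w Z ≠ j) :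
    Disjoint (cellSites cell (b Z) ∪ cellSites cell (w Z)) (whiteSites cell white j) := by
  unfold whiteSites
  split_ifs with hw
  · refine Finset.disjoint_union_left.2 ⟨disjoint_cellSites cell ?_, disjoint_cellSites cell hj⟩
    rcases h.color Z with h1 | h1
    · rwa [h1]
    · exact fun h2 => h1.2 (h2 ▸ hw)
  · simp

lemma generators_star (h : IsTwoCellFamily q cell white b w) (t : ι × ι) {x : Op V α}
    (hx : x ∈ cellGenerators q cell white b w t) : star x ∈ cellGenerators q cell white b w t := by
  rcases hx with ⟨Z, hw, hb, y, y', rfl⟩ | ⟨h1, h2⟩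
  · refine Or.inl ⟨Z, hw, hb, y', y, ?_⟩
    rw [(unitOn_isMatrixUnits _).component_star, (h.proj Z).isSelfAdjoint.star_eq]
  · exact Or.inr ⟨h1, h2.star⟩

/-- A term acts on its black cell and its white cell, and its components along matrix units of the
white cell act trivially on the latter. -/
lemma generators_supportedOn [Nonempty α] (h : IsTwoCellFamily q cell white b w) (t : ι × ι)
    {x : Op V α} (hx : x ∈ cellGenerators q cell white b w t) :
    SupportedOn (cellSites cell t.1) x := by
  rcases hx with ⟨Z, hw, hb, y, y', rfl⟩ | ⟨h1, h2⟩
  · refine supportedOn_of_commute_site fun v hv K hK => ?_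
    by_cases hvW : v ∈ whiteSites cell white t.2
    · refine ((hK.mono (Finset.singleton_subset_iff.2 hvW)).commute_of_units fun a c => ?_).symm
      exact ((unitOn_isMatrixUnits _).component_commute _ _ _ _ _).symm
    · refine component_commute_of_commute ?_ (fun a c => ?_) y y'
      · refine (h.supp Z).commute (Finset.disjoint_singleton_right.2 fun hv' => ?_) hK
        rcases Finset.mem_union.1 hv' with h1 | h1
        · exact hv (hb ▸ h1)
        · rcases h.color Z with h2 | h2
          · exact hv (hb ▸ h2 ▸ h1)
          · rw [hw] at h1 h2
            exact hvW (by rw [whiteSites, if_pos h2.1]; exact h1)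
      · exact (unitOn_supportedOn _ a c).commute (Finset.disjoint_singleton_right.2 hvW) hK
  · rw [h1]
    exact h2.mono (whiteSites_subset _ _ _)

/-- On a common cell with different owners, the matrix units of each owner commute with the other
owner's terms by `disjoint_whiteSites`. The vanishing commutator of the terms therefore passes to
their components. On different cells the supports are disjoint. -/
lemma generators_commute [Nonempty α] (h : IsTwoCellFamily q cell white b w) {t t' : ι × ι}
    (ht : t ≠ t') {x y : Op V α} (hx : x ∈ cellGenerators q cell white b w t)
    (hy : y ∈ cellGenerators q cell white b w t') : Commute x y := by
  by_cases h1 : t.1 = t'.1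
  · have h2 : t.2 ≠ t'.2 := fun h2 => ht (Prod.ext h1 h2)
    have hWW : Disjoint (whiteSites cell white t.2) (whiteSites cell white t'.2) :=
      Finset.disjoint_of_subset_left (whiteSites_subset _ _ _)
        (Finset.disjoint_of_subset_right (whiteSites_subset _ _ _) (disjoint_cellSites cell h2))
    rcases hx with ⟨Z, hw, hb, a, a', rfl⟩ | ⟨_, hx⟩ <;>
      rcases hy with ⟨Z', hw', hb', c, c', rfl⟩ | ⟨_, hy⟩
    · have hZ : ∀ d d', Commute (q Z) (unitOn (whiteSites cell white t'.2) d d') := fun d d' =>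
        (h.supp Z).commute (h.disjoint_whiteSites (hw ▸ h2)) (unitOn_supportedOn _ d d')
      have hZ' : ∀ d d', Commute (q Z') (unitOn (whiteSites cell white t.2) d d') := fun d d' =>
        (h.supp Z').commute (h.disjoint_whiteSites (hw' ▸ h2.symm)) (unitOn_supportedOn _ d d')
      refine component_commute_of_commute ?_ (fun d d' => ?_) a a'
      · exact (component_commute_of_commute (h.comm Z' Z) (fun d d' => (hZ d d').symm) c c').symm
      · refine (component_commute_of_commute (hZ' d d') (fun e e' => ?_) c c').symm
        exact (unitOn_supportedOn _ e e').commute hWW.symm (unitOn_supportedOn _ d d')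
    · refine component_commute_of_commute ?_ (fun d d' => ?_) a a'
      · exact (h.supp Z).commute (h.disjoint_whiteSites (hw ▸ h2)) hy
      · exact (unitOn_supportedOn _ d d').commute hWW hy
    · refine (component_commute_of_commute ?_ (fun d d' => ?_) c c').symm
      · exact (h.supp Z').commute (h.disjoint_whiteSites (hw' ▸ h2.symm)) hx
      · exact (unitOn_supportedOn _ d d').commute hWW.symm hx
    · exact hx.commute hWW hy
  · exact (h.generators_supportedOn t hx).commute (disjoint_cellSites cell h1)
      (h.generators_supportedOn t' hy)

end IsTwoCellFamily

/-- The algebra on the cell `t.1` of the terms that belong to the cell `t.2`. -/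
def cellAlgebra (q : ζ → Op V α) (cell : V → ι) (white : ι → Prop) (b w : ζ → ι) (t : ι × ι) :
    Subalgebra ℂ (Op V α) :=
  Algebra.adjoin ℂ (cellGenerators q cell white b w t)

/-- In the expansion of a term, the components lie in the algebra of its cell `b Z` and the matrix
units in that of its owner `w Z`. Both belong to the same owner. -/
lemma mem_sup_cellAlgebra (q : ζ → Op V α) (cell : V → ι) (white : ι → Prop) (b w : ζ → ι)
    (Z : ζ) :
    q Z ∈ Finset.univ.sup fun i => cellAlgebra q cell white b w (i, w Z) := by
  have hle : ∀ i, cellAlgebra q cell white b w (i, w Z) ≤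
      Finset.univ.sup fun i => cellAlgebra q cell white b w (i, w Z) := fun i =>
    Finset.le_sup (f := fun i => cellAlgebra q cell white b w (i, w Z)) (Finset.mem_univ i)
  rw [(unitOn_isMatrixUnits (whiteSites cell white (w Z))).sum_component (q Z)]
  refine Subalgebra.sum_mem _ fun y _ => Subalgebra.sum_mem _ fun y' _ => Subalgebra.mul_mem _ ?_ ?_
  · exact hle (b Z) (Algebra.subset_adjoin (Or.inl ⟨Z, rfl, rfl, y, y', rfl⟩))
  · exact hle (w Z) (Algebra.subset_adjoin (Or.inr ⟨rfl, unitOn_supportedOn _ _ _⟩))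

namespace IsTwoCellFamily

variable {q : ζ → Op V α} {cell : V → ι} {white : ι → Prop} {b w : ζ → ι}

lemma cellAlgebra_le [Nonempty α] (h : IsTwoCellFamily q cell white b w) (t : ι × ι) :
    cellAlgebra q cell white b w t ≤ supportAlgebra α (cellSites cell t.1) :=
  Algebra.adjoin_le fun _ hx => mem_supportAlgebra.2 (h.generators_supportedOn t hx)

lemma cellAlgebra_le_region [Nonempty α] (h : IsTwoCellFamily q cell white b w) (t : ι × ι) :
    cellAlgebra q cell white b w t ≤ supportAlgebra α (cellRegion cell b w t.2) := by
  refine Algebra.adjoin_le fun x hx => mem_supportAlgebra.2 ?_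
  refine (h.generators_supportedOn t hx).mono fun v hv => ?_
  rw [mem_cellSites] at hv
  simp only [cellRegion, Finset.mem_filter, Finset.mem_univ, true_and]
  rcases hx with ⟨Z, hw, hb, -⟩ | ⟨h1, -⟩
  · exact Or.inr ⟨Z, hw, hv.trans hb.symm⟩
  · exact Or.inl (hv.trans h1)

lemma cellAlgebra_commute [Nonempty α] (h : IsTwoCellFamily q cell white b w) (t t' : ι × ι)
    (ht : t ≠ t') : ∀ x ∈ cellAlgebra q cell white b w t,
      ∀ y ∈ cellAlgebra q cell white b w t', Commute x y := fun _ hx _ hy =>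
  Subalgebra.commute_of_mem_adjoin (fun _ hx _ hy => h.generators_commute ht hx hy) hx hy

/-- This is why the rotation made for one owner preserves the terms already satisfied for another.
-/
lemma sup_cellAlgebra_commute [Nonempty α] (h : IsTwoCellFamily q cell white b w) {j l : ι}
    (hjl : j ≠ l) {x y : Op V α}
    (hx : x ∈ Finset.univ.sup fun i => cellAlgebra q cell white b w (i, j))
    (hy : y ∈ Finset.univ.sup fun i => cellAlgebra q cell white b w (i, l)) : Commute x y := by
  have hi : ∀ i i' : ι, (i, j) ≠ (i', l) := fun i i' h => hjl (Prod.ext_iff.1 h).2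
  have h1 : ∀ i, ∀ a ∈ cellAlgebra q cell white b w (i, j), Commute a y := by
    intro i a ha
    have : (Finset.univ.sup fun i => cellAlgebra q cell white b w (i, l)) ≤
        Subalgebra.centralizer ℂ {a} := Finset.sup_le fun i' _ c hc =>
      (Subalgebra.mem_centralizer_iff ℂ).2 fun a' ha' => by
        rw [Set.mem_singleton_iff.1 ha']
        exact h.cellAlgebra_commute _ _ (hi i i') a ha c hc
    exact (Subalgebra.mem_centralizer_iff ℂ).1 (this hy) a rfl
  have : (Finset.univ.sup fun i => cellAlgebra q cell white b w (i, j)) ≤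
      Subalgebra.centralizer ℂ {y} := Finset.sup_le fun i _ a ha =>
    (Subalgebra.mem_centralizer_iff ℂ).2 fun y' hy' => by
      rw [Set.mem_singleton_iff.1 hy']
      exact (h1 i a ha).symm
  exact ((Subalgebra.mem_centralizer_iff ℂ).1 (this hx) y rfl).symm

/-- A unitary in the algebra of a cell that rotates a minimal projection into the common range of
the terms that belong to the cell. -/
lemma exists_cell_rotation [Nonempty α] (h : IsTwoCellFamily q cell white b w)
    {v : (V → α) → ℂ} (hqv : ∀ Z, q Z *ᵥ v = v) {p : ι × ι → Op V α} {k : (V → α) → ℂ}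
    (hp : ∀ t, IsMinimalProjection (cellAlgebra q cell white b w t) (p t))
    (hpk : ∀ t, p t *ᵥ k = k) (hkv : star k ⬝ᵥ v ≠ 0) (j : ι) :
    ∃ π U : Op V α, (∀ k, (∀ i, p (i, j) *ᵥ k = k) → π *ᵥ k = k) ∧
      U ∈ (Finset.univ.sup fun i => cellAlgebra q cell white b w (i, j)) ∧
      U ∈ Matrix.unitaryGroup (V → α) ℂ ∧ ∀ Z, w Z = j → q Z * (U * π) = U * π := by
  classical
  obtain ⟨π, hπ, -, hπk⟩ := exists_joint_isMinimalProjection Finset.univ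
    (fun i => cellAlgebra q cell white b w (i, j))
    (fun i i' hi => h.cellAlgebra_commute _ _ fun h' => hi (Prod.ext_iff.1 h').1)
    (fun i => p (i, j)) fun i => hp (i, j)
  obtain ⟨r, hrA, hr, hqr, hrk⟩ := exists_joint_projection
    (Finset.univ.filter fun Z => w Z = j) q (fun Z _ => h.proj Z) fun Z _ Z' _ => h.comm Z Z'
  have hrM : r ∈ Finset.univ.sup fun i => cellAlgebra q cell white b w (i, j) := by
    refine Algebra.adjoin_le ?_ hrA
    rintro _ ⟨Z, hZ, rfl⟩
    rw [← (Finset.mem_filter.1 hZ).2]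
    exact mem_sup_cellAlgebra q cell white b w Z
  obtain ⟨c, hc⟩ := hπ.corner r hrM
  -- π fixes `k` and r fixes `v`, so π r = 0 would make `k` orthogonal to `v`.
  have hne : r * π ≠ 0 := by
    intro h0
    have h1 : π * r = 0 := by
      have := congrArg star h0
      rwa [star_mul, hr.isSelfAdjoint.star_eq, hπ.proj.isSelfAdjoint.star_eq, star_zero] at this
    apply hkv
    have hπs : πᴴ = π := hπ.proj.isSelfAdjoint
    rw [← hπk k fun i _ => hpk (i, j), Matrix.star_mulVec, hπs, ← Matrix.dotProduct_mulVec,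
      ← hrk v fun Z _ => hqv Z, Matrix.mulVec_mulVec, h1, Matrix.zero_mulVec, dotProduct_zero]
  obtain ⟨U, hUA, hUU, hrU⟩ := exists_unitary_rotation _ hπ.proj hr hπ.mem hrM hc hne
  refine ⟨π, U, fun k hk => hπk k fun i _ => hk i, hUA, hUU, fun Z hZ => ?_⟩
  rw [← hrU, ← mul_assoc, hqr Z (by simp [hZ])]

/-- A common fixed vector of the projections, prepared from a basis state by unitaries on the cells
and unitaries on the regions of the cells. -/
theorem exists_circuit [Nonempty α] (h : IsTwoCellFamily q cell white b w) {v : (V → α) → ℂ}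
    (hv : v ≠ 0) (hqv : ∀ Z, q Z *ᵥ v = v) :
    ∃ (σ : V → α) (G U : ι → Op V α),
      (∀ i, G i ∈ Matrix.unitaryGroup (V → α) ℂ ∧ SupportedOn (cellSites cell i) (G i)) ∧
      (∀ j, U j ∈ Matrix.unitaryGroup (V → α) ℂ ∧ SupportedOn (cellRegion cell b w j) (U j)) ∧
      ∀ l l' : List ι, l.Nodup → (∀ i, i ∈ l) → l'.Nodup → (∀ i, i ∈ l') → ∀ Z,
        q Z *ᵥ (((l'.map U).prod * (l.map G).prod) *ᵥ Pi.single σ 1) =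
          ((l'.map U).prod * (l.map G).prod) *ᵥ Pi.single σ 1 := by
  classical
  -- The vector `k` may be entangled. It only certifies that the projections are compatible with
  -- each other and with `v`; the circuit starts from a basis state `σ` in its support.
  obtain ⟨p, k, hp, hpk, hkv⟩ := exists_isMinimalProjection_family
    (cellAlgebra q cell white b w) (fun t _ hx => star_mem_adjoin (fun _ => h.generators_star t) hx)
    h.cellAlgebra_commute hv
  have hU := h.exists_cell_rotation hqv hp hpk hkv
  choose π U hπk hUA hUU hqU using hU
  have hk0 : k ≠ 0 := by
    rintro rfl
    simp at hkv
  obtain ⟨σ, hσ⟩ := Function.ne_iff.1 hk0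
  have hpX : ∀ t, SupportedOn (cellSites cell t.1) (p t) := fun t =>
    mem_supportAlgebra.1 (h.cellAlgebra_le t (hp t).mem)
  have hG : ∀ i, ∃ G : Op V α, SupportedOn (cellSites cell i) G ∧
      G ∈ Matrix.unitaryGroup (V → α) ℂ ∧
      ∀ j, p (i, j) *ᵥ (G *ᵥ Pi.single σ 1) = G *ᵥ Pi.single σ 1 := by
    intro i
    refine exists_unitary_fixing (cellSites cell i) (fun j => p (i, j))
      (fun j => (hp (i, j)).proj)
      (fun j => hpX (i, j)) (fun j j' => ?_) (fun j => hpk (i, j)) hσ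
    by_cases hj : j = j'
    · rw [hj]
    · exact h.cellAlgebra_commute (i, j) (i, j') (fun h' => hj (Prod.ext_iff.1 h').2) _
        (hp (i, j)).mem _ (hp (i, j')).mem
  choose G hGS hGU hpG using hG
  refine ⟨σ, G, U, fun i => ⟨hGU i, hGS i⟩, fun j => ⟨hUU j, ?_⟩, ?_⟩
  · have : (Finset.univ.sup fun i => cellAlgebra q cell white b w (i, j)) ≤
        supportAlgebra α (cellRegion cell b w j) :=
      Finset.sup_le fun i _ => h.cellAlgebra_le_region (i, j)
    exact mem_supportAlgebra.1 (this (hUA j))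
  · intro l l' hl hl1 hl' hl1' Z
    have hGc : ∀ i i', i ≠ i' → Commute (G i) (G i') := fun i i' hi =>
      (hGS i).commute (disjoint_cellSites cell hi) (hGS i')
    have hΦ : ∀ i j, p (i, j) *ᵥ ((l.map G).prod *ᵥ Pi.single σ 1) =
        (l.map G).prod *ᵥ Pi.single σ 1 := by
      intro i j
      obtain ⟨R, hR, hRc⟩ := List.exists_prod_map_eq_mul G hGc hl (hl1 i)
      have : Commute (p (i, j)) R := hRc _ fun i' hi' =>
        (hpX (i, j)).commute (disjoint_cellSites cell hi'.symm) (hGS i')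
      rw [hR, ← Matrix.mulVec_mulVec, Matrix.mulVec_mulVec, this.eq, ← Matrix.mulVec_mulVec, hpG]
    obtain ⟨R, hR, hRc⟩ := List.exists_prod_map_eq_mul U
      (fun j j' hj => h.sup_cellAlgebra_commute hj (hUA j) (hUA j')) hl' (hl1' (w Z))
    have hqR : Commute (q Z) R := hRc _ fun j hj =>
      h.sup_cellAlgebra_commute hj.symm (mem_sup_cellAlgebra q cell white b w Z) (hUA j)
    have hπΦ := hπk (w Z) _ fun i => hΦ i (w Z)
    -- `R` collects the rotations of other owners and commutes with `q Z`, so the rotation of the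
    -- owner of `Z` alone satisfies the term.
    have key : q Z * (R * U (w Z) * π (w Z)) = R * U (w Z) * π (w Z) := by
      rw [mul_assoc R, ← mul_assoc (q Z), hqR.eq, mul_assoc R, hqU (w Z) Z rfl]
    rw [← Matrix.mulVec_mulVec, hR, ← hπΦ, Matrix.mulVec_mulVec (M := R * U (w Z)),
      Matrix.mulVec_mulVec (M := q Z), key]

end IsTwoCellFamily

end Cells

/-! ### System and ancilla operators -/

section Ancilla

variable {L D : ℕ}

/-- Configurations of the sites with ancillas as pairs of configurations. -/
def realAncillaEquiv (L D : ℕ) :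
    (Site L → Fin D × Fin D) ≃ (Site L → Fin D) × (Site L → Fin D) where
  toFun σ := (fun s => (σ s).1, fun s => (σ s).2)
  invFun p := fun s => (p.1 s, p.2 s)
  left_inv _ := rfl
  right_inv _ := rfl

lemma withAncilla_eq_submatrix (H : Op (Site L) (Fin D)) :
    withAncilla H = (H ⊗ₖ (1 : Op (Site L) (Fin D))).submatrix (realAncillaEquiv L D)
      (realAncillaEquiv L D) := by
  ext σ τ
  simp only [withAncilla, Matrix.submatrix_apply, Matrix.kroneckerMap_apply, realAncillaEquiv,
    Equiv.coe_fn_mk, Matrix.one_apply, mul_ite, mul_one, mul_zero]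
  congr 1
  simp [funext_iff]

/-- `withAncilla` as a homomorphism of star algebras. -/
def realHom (L D : ℕ) : Op (Site L) (Fin D) →⋆ₐ[ℂ] Op (Site L) (Fin D × Fin D) where
  toFun := withAncilla
  map_one' := by
    rw [withAncilla_eq_submatrix, Matrix.one_kronecker_one, Matrix.submatrix_one_equiv]
  map_mul' M N := by
    rw [withAncilla_eq_submatrix, withAncilla_eq_submatrix, withAncilla_eq_submatrix,
      Matrix.submatrix_mul_equiv, ← Matrix.mul_kronecker_mul, one_mul]
  map_zero' := by
    ext σ τ
    simp [withAncilla]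
  map_add' M N := by
    ext σ τ
    simp only [withAncilla, Matrix.add_apply]
    split_ifs <;> simp
  commutes' c := by
    simp only [Algebra.algebraMap_eq_smul_one]
    rw [withAncilla_eq_submatrix, Matrix.smul_kronecker, Matrix.one_kronecker_one]
    ext σ τ
    simp [Matrix.one_apply]
  map_star' M := by
    ext σ τ
    simp only [withAncilla, Matrix.star_apply, eq_comm]
    split_ifs <;> simp

lemma realHom_apply (H : Op (Site L) (Fin D)) : realHom L D H = withAncilla H := rfl

/-- The action of an operator on the ancillas. -/
def ancillaHom (L D : ℕ) : Op (Site L) (Fin D) →⋆ₐ[ℂ] Op (Site L) (Fin D × Fin D) where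
  toFun K := ((1 : Op (Site L) (Fin D)) ⊗ₖ K).submatrix (realAncillaEquiv L D)
    (realAncillaEquiv L D)
  map_one' := by rw [Matrix.one_kronecker_one, Matrix.submatrix_one_equiv]
  map_mul' M N := by rw [Matrix.submatrix_mul_equiv, ← Matrix.mul_kronecker_mul, one_mul]
  map_zero' := by simp
  map_add' M N := by
    rw [Matrix.kronecker_add]
    rfl
  commutes' c := by
    simp only [Algebra.algebraMap_eq_smul_one]
    rw [Matrix.kronecker_smul, Matrix.one_kronecker_one]
    ext σ τ
    simp [Matrix.one_apply]
  map_star' M := by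
    rw [Matrix.star_eq_conjTranspose, Matrix.star_eq_conjTranspose, Matrix.conjTranspose_submatrix,
      Matrix.conjTranspose_kronecker, Matrix.conjTranspose_one]

lemma realHom_commute_ancillaHom (H K : Op (Site L) (Fin D)) :
    Commute (realHom L D H) (ancillaHom L D K) := by
  have h : ancillaHom L D K = ((1 : Op (Site L) (Fin D)) ⊗ₖ K).submatrix (realAncillaEquiv L D)
    (realAncillaEquiv L D) := rfl
  rw [Commute, SemiconjBy, realHom_apply, withAncilla_eq_submatrix, h, Matrix.submatrix_mul_equiv,
    Matrix.submatrix_mul_equiv, ← Matrix.mul_kronecker_mul, ← Matrix.mul_kronecker_mul]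
  simp

lemma supportedOn_realHom [NeZero D] {X : Finset (Site L)} {O : Op (Site L) (Fin D)}
    (hO : SupportedOn X O) : SupportedOn X (realHom L D O) := by
  refine supportedOn_of_actsTriviallyAt fun v hv => ⟨fun σ τ h => ?_, fun σ τ c h => ?_⟩
  · have h0 := (hO.actsTriviallyAt hv).1 (fun s => (σ s).1) fun s => (τ s).1
    simp only [realHom_apply, withAncilla]
    split_ifs with h'
    · exact h0 fun h1 => h (Prod.ext h1 (h' v))
    · rfl
  · have h0 := (hO.actsTriviallyAt hv).2 (fun s => (σ s).1) (fun s => (τ s).1) c.1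
      (congrArg Prod.fst h)
    have hu : ∀ ρ : Site L → Fin D × Fin D, (fun s => (Function.update ρ v c s).1) =
        Function.update (fun s => (ρ s).1) v c.1 := fun ρ => by
      funext s
      by_cases hs : s = v
      · subst hs; simp
      · simp [hs]
    simp only [realHom_apply, withAncilla, hu, h0]
    congr 1
    refine propext (forall_congr' fun s => ?_)
    by_cases hs : s = v
    · subst hs; simp [h]
    · simp [hs]

lemma supportedOn_ancillaHom [NeZero D] {X : Finset (Site L)} {O : Op (Site L) (Fin D)}
    (hO : SupportedOn X O) : SupportedOn X (ancillaHom L D O) := by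
  have hap : ∀ σ τ : Site L → Fin D × Fin D, ancillaHom L D O σ τ =
      if ∀ s, (σ s).1 = (τ s).1 then O (fun s => (σ s).2) (fun s => (τ s).2) else 0 := by
    intro σ τ
    change (1 : Op (Site L) (Fin D)) _ _ * O _ _ = _
    rw [Matrix.one_apply, ite_mul, one_mul, zero_mul]
    congr 1
    simp [realAncillaEquiv, funext_iff]
  refine supportedOn_of_actsTriviallyAt fun v hv => ⟨fun σ τ h => ?_, fun σ τ c h => ?_⟩
  · have h0 := (hO.actsTriviallyAt hv).1 (fun s => (σ s).2) fun s => (τ s).2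
    rw [hap]
    split_ifs with h'
    · exact h0 fun h1 => h (Prod.ext (h' v) h1)
    · rfl
  · have h0 := (hO.actsTriviallyAt hv).2 (fun s => (σ s).2) (fun s => (τ s).2) c.2
      (congrArg Prod.snd h)
    have hu : ∀ ρ : Site L → Fin D × Fin D, (fun s => (Function.update ρ v c s).2) =
        Function.update (fun s => (ρ s).2) v c.2 := fun ρ => by
      funext s
      by_cases hs : s = v
      · subst hs; simp
      · simp [hs]
    simp only [hap, hu, h0]
    congr 1
    refine propext (forall_congr' fun s => ?_)
    by_cases hs : s = v
    · subst hs; simp [h]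
    · simp [hs]

/-- The tensor product of a state of the system and a state of the ancillas. -/
def tensorVec (φ χ : (Site L → Fin D) → ℂ) : (Site L → Fin D × Fin D) → ℂ :=
  fun σ => φ (fun s => (σ s).1) * χ fun s => (σ s).2

lemma realHom_mulVec_tensorVec (H : Op (Site L) (Fin D)) (φ χ : (Site L → Fin D) → ℂ) :
    realHom L D H *ᵥ tensorVec φ χ = tensorVec (H *ᵥ φ) χ := by
  ext σ
  rw [realHom_apply, withAncilla_eq_submatrix]
  simp only [Matrix.mulVec, dotProduct, tensorVec, Matrix.submatrix_apply]
  rw [← (realAncillaEquiv L D).symm.sum_comp, Fintype.sum_prod_type, Finset.sum_mul]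
  refine Finset.sum_congr rfl fun τ _ => ?_
  simp [Matrix.kroneckerMap_apply, Matrix.one_apply, realAncillaEquiv, mul_assoc]

lemma ancillaHom_mulVec_tensorVec (K : Op (Site L) (Fin D)) (φ χ : (Site L → Fin D) → ℂ) :
    ancillaHom L D K *ᵥ tensorVec φ χ = tensorVec φ (K *ᵥ χ) := by
  ext σ
  change (((1 : Op (Site L) (Fin D)) ⊗ₖ K).submatrix (realAncillaEquiv L D)
    (realAncillaEquiv L D) *ᵥ _) σ = _
  simp only [Matrix.mulVec, dotProduct, tensorVec, Matrix.submatrix_apply]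
  rw [← (realAncillaEquiv L D).symm.sum_comp, Fintype.sum_prod_type_right, Finset.mul_sum]
  refine Finset.sum_congr rfl fun τ _ => ?_
  simp [Matrix.kroneckerMap_apply, Matrix.one_apply, realAncillaEquiv, mul_left_comm]

lemma realHom_mem_unitaryGroup {U : Op (Site L) (Fin D)}
    (hU : U ∈ Matrix.unitaryGroup (Site L → Fin D) ℂ) :
    realHom L D U ∈ Matrix.unitaryGroup (Site L → Fin D × Fin D) ℂ := by
  rw [Matrix.mem_unitaryGroup_iff] at hU ⊢
  rw [← map_star, ← map_mul, hU, map_one]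

end Ancilla

/-! ### Products and exchange of systems of matrix units -/

section MatrixUnits

variable {N : Type*} [Fintype N] [DecidableEq N]

lemma IsMatrixUnits.component_mul {κ : Type*} [Fintype κ] [DecidableEq κ]
    {E : κ → κ → Matrix N N ℂ} (hE : IsMatrixUnits E) (O : Matrix N N ℂ) (y y' : κ) :
    component E O y y' * E y y' = E y y * O * E y' y' := by
  simp only [component, Finset.sum_mul, mul_assoc, hE.mul]
  simp

lemma IsMatrixUnits.prod {κ κ' : Type*} [Fintype κ] [DecidableEq κ] [Fintype κ'] [DecidableEq κ']
    {E : κ → κ → Matrix N N ℂ} {E' : κ' → κ' → Matrix N N ℂ} (hE : IsMatrixUnits E)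
    (hE' : IsMatrixUnits E') (hc : ∀ a b c d, Commute (E a b) (E' c d)) :
    IsMatrixUnits fun k l : κ × κ' => E k.1 l.1 * E' k.2 l.2 := by
  refine ⟨fun k l m n => ?_, fun k l => ?_, ?_⟩
  · have : E k.1 l.1 * E' k.2 l.2 * (E m.1 n.1 * E' m.2 n.2) =
        (E k.1 l.1 * E m.1 n.1) * (E' k.2 l.2 * E' m.2 n.2) := by
      rw [mul_assoc, ← mul_assoc (E' _ _), ← (hc m.1 n.1 k.2 l.2).eq, mul_assoc, mul_assoc]
    rw [this, hE.mul, hE'.mul]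
    by_cases h1 : l.1 = m.1 <;> by_cases h2 : l.2 = m.2 <;> simp [Prod.ext_iff, h1, h2]
  · rw [star_mul, hE.star_eq, hE'.star_eq, (hc _ _ _ _).eq]
  · rw [Fintype.sum_prod_type]
    simp only [← Finset.mul_sum, hE'.sum, mul_one, hE.sum]

/-- The partial exchange of two commuting systems of matrix units. -/
lemma exists_exchange {κ : Type*} [Fintype κ] [DecidableEq κ] {F G : κ → κ → Matrix N N ℂ}
    (hF : IsMatrixUnits F) (hGm : ∀ a b c d, G a b * G c d = if b = c then G a d else 0)
    (hGs : ∀ a b, star (G a b) = G b a) (hc : ∀ a b c d, Commute (F a b) (G c d))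
    (A : Subalgebra ℂ (Matrix N N ℂ)) (hFA : ∀ a b, F a b ∈ A) (hGA : ∀ a b, G a b ∈ A) :
    ∃ W ∈ A, W ∈ Matrix.unitaryGroup N ℂ ∧
      (∀ x, (∀ a b, Commute x (F a b)) → (∀ a b, Commute x (G a b)) → Commute x W) ∧
      ∀ k, F k k * (W * G k k) = W * G k k := by
  -- `P` is the swap of the two factors. The units `G` need not sum to 1, so `P` squares to `e`
  -- only, and adding 1 - e makes it unitary.
  set P := ∑ k, ∑ l, F k l * G l k with hP
  set e := ∑ k, G k k with he
  have hswap : ∀ a b c d a' b' c' d', F a b * G c d * (F a' b' * G c' d') =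
      (F a b * F a' b') * (G c d * G c' d') := fun a b c d a' b' c' d' => by
    rw [mul_assoc, ← mul_assoc (G _ _), ← (hc a' b' c d).eq, mul_assoc, mul_assoc]
  have hGe : ∀ a b, G a b * e = G a b := fun a b => by
    simp [he, Finset.mul_sum, hGm]
  have heG : ∀ a b, e * G a b = G a b := fun a b => by
    simp [he, Finset.sum_mul, hGm]
  have hFe : ∀ a b, Commute (F a b) e := fun a b => Commute.sum_right _ _ _ fun k _ => hc _ _ _ _
  have hPe : P * e = P := by
    simp only [hP, Finset.sum_mul, mul_assoc, hGe]
  have heP : e * P = P := by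
    simp only [hP, Finset.mul_sum, ← mul_assoc, ← (hFe _ _).eq]
    simp only [mul_assoc, heG]
  have hPP : P * P = e := by
    have h1 : ∀ k l, F k l * G l k * P = F k k * G l l := fun k l => by
      simp only [hP, Finset.mul_sum, hswap, hF.mul, hGm]
      simp [ite_mul, mul_ite]
    nth_rw 1 [hP]
    simp only [Finset.sum_mul, h1]
    rw [Finset.sum_comm]
    simp only [← Finset.sum_mul, hF.sum, one_mul, he]
  have hPs : star P = P := by
    simp only [hP, star_sum, star_mul, hF.star_eq, hGs]
    rw [Finset.sum_comm]
    exact Finset.sum_congr rfl fun k _ => Finset.sum_congr rfl fun l _ => (hc _ _ _ _).eq.symm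
  have hes : star e = e := by simp [he, star_sum, hGs]
  have hee : e * e = e := by
    nth_rw 2 [he]
    rw [Finset.mul_sum]
    exact Finset.sum_congr rfl fun k _ => heG k k
  have hPA : P ∈ A := Subalgebra.sum_mem _ fun k _ => Subalgebra.sum_mem _ fun l _ =>
    A.mul_mem (hFA _ _) (hGA _ _)
  have heA : e ∈ A := Subalgebra.sum_mem _ fun k _ => hGA _ _
  refine ⟨P + (1 - e), A.add_mem hPA (A.sub_mem A.one_mem heA), ?_, ?_, ?_⟩
  · rw [Matrix.mem_unitaryGroup_iff, star_add, star_sub, star_one, hPs, hes]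
    have : (P + (1 - e)) * (P + (1 - e)) =
        P * P + (P - P * e) + (P - e * P) + (1 - e - e + e * e) := by noncomm_ring
    rw [this, hPP, hPe, heP, hee]
    abel
  · intro x hxF hxG
    refine Commute.add_right (Commute.sum_right _ _ _ fun k _ => Commute.sum_right _ _ _ fun l _ =>
      (hxF _ _).mul_right (hxG _ _)) ((Commute.one_right _).sub_right ?_)
    exact Commute.sum_right _ _ _ fun k _ => hxG _ _
  · intro k
    have : (P + (1 - e)) * G k k = ∑ l, F k l * G l k := by
      rw [add_mul, sub_mul, one_mul, heG, sub_self, add_zero]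
      simp only [hP, Finset.sum_mul, mul_assoc, hGm]
      simp
    rw [this, Finset.mul_sum]
    simp only [← mul_assoc, hF.mul, if_true]

end MatrixUnits

/-! ### Recovering an algebra from its interaction algebra -/

section InteractionAlgebra

variable {V α : Type*} [Fintype V] [DecidableEq V] [Fintype α] [DecidableEq α]

lemma partialTrace_mul_unit_apply (X : Finset V) (O : Op V α) (y y' : (Xᶜ : Finset V) → α)
    (x x' : X → α) :
    partialTrace X (O * extendOp Xᶜ (Matrix.single y' y 1)) x x' =
      O (glue X x y) (glue X x' y') := by
  set e := splitEquiv α X with he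
  have hglue : ∀ a b, glue X a b = e.symm (a, b) := fun _ _ => rfl
  simp only [partialTrace, hglue]
  rw [extendOp_compl_eq_submatrix]
  simp only [Matrix.mul_apply]
  have h1 : ∀ z, ∑ τ, O (e.symm (x, z)) τ *
      ((1 : Op X α) ⊗ₖ Matrix.single y' y (1 : ℂ)).submatrix e e τ (e.symm (x', z)) =
      if y = z then O (e.symm (x, z)) (e.symm (x', y')) else 0 := by
    intro z
    rw [← e.symm.sum_comp, Fintype.sum_prod_type]
    simp [Matrix.kroneckerMap_apply, Matrix.one_apply, Matrix.single_apply, ite_and]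
  rw [Finset.sum_congr rfl fun z _ => h1 z]
  simp

/-- The partial trace against |y'⟩⟨y| on the complement reads off the block (y, y') of `O`, and the
blocks reassemble `O`. So the interaction algebra captures all of the action on `X`. -/
lemma eq_sum_partialTrace_mul (X : Finset V) (O : Op V α) :
    O = ∑ y, ∑ y', extendOp X (partialTrace X (O * extendOp Xᶜ (Matrix.single y' y 1))) *
      unitOn Xᶜ y y' := by
  set e := splitEquiv α X with he
  have hglue : ∀ a b, glue X a b = e.symm (a, b) := fun _ _ => rfl
  ext σ τ
  obtain ⟨⟨a, b⟩, rfl⟩ := e.symm.surjective σ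
  obtain ⟨⟨a', b'⟩, rfl⟩ := e.symm.surjective τ
  simp only [Matrix.sum_apply, unitOn]
  have h1 : ∀ y y', (extendOp X (partialTrace X (O * extendOp Xᶜ (Matrix.single y' y 1))) *
      extendOp Xᶜ (Matrix.single y y' 1)) (e.symm (a, b)) (e.symm (a', b')) =
      if y = b then if y' = b' then O (e.symm (a, b)) (e.symm (a', b')) else 0 else 0 := by
    intro y y'
    rw [extendOp_eq_submatrix X, extendOp_compl_eq_submatrix X (Matrix.single y y' 1),
      Matrix.submatrix_mul_equiv, ← Matrix.mul_kronecker_mul]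
    simp only [Matrix.submatrix_apply, ← he, Equiv.apply_symm_apply, mul_one, one_mul,
      Matrix.kroneckerMap_apply, partialTrace_mul_unit_apply, Matrix.single_apply, hglue]
    split_ifs <;> simp_all
  simp only [h1]
  simp

/-- An operator on `X` that commutes with the interaction algebra of `A` commutes with `A`. -/
lemma commute_of_commute_interactionAlgebra [Nonempty α] {A : Subalgebra ℂ (Op V α)} {X : Finset V}
    {M : Op X α} (hM : ∀ x ∈ interactionAlgebra A X, Commute M x) {O : Op V α} (hO : O ∈ A) :
    Commute (extendOp X M) O := by
  rw [eq_sum_partialTrace_mul X O]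
  refine Commute.sum_right _ _ _ fun y _ => Commute.sum_right _ _ _ fun y' _ =>
    Commute.mul_right ?_ ?_
  · exact (hM _ (Algebra.subset_adjoin ⟨O, hO, _, rfl⟩)).map (extendHom α X)
  · exact SupportedOn.commute disjoint_compl_right ⟨M, rfl⟩ (unitOn_supportedOn _ y y')

end InteractionAlgebra

/-- Conjugation by a unitary between matrix algebras. -/
def conjHom {n m : Type*} [Fintype n] [DecidableEq n] [Fintype m] [DecidableEq m]
    (u : Matrix n m ℂ) (h1 : u * uᴴ = 1) (h2 : uᴴ * u = 1) : Matrix n n ℂ →⋆ₐ[ℂ] Matrix m m ℂ where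
  toFun x := uᴴ * x * u
  map_one' := by rw [Matrix.mul_one, h2]
  map_mul' x y := by
    have : uᴴ * x * u * (uᴴ * y * u) = uᴴ * x * (u * uᴴ) * y * u := by
      simp only [Matrix.mul_assoc]
    rw [this, h1, Matrix.mul_one]
    simp only [Matrix.mul_assoc]
  map_zero' := by simp
  map_add' x y := by rw [Matrix.mul_add, Matrix.add_mul]
  commutes' c := by
    simp only [Algebra.algebraMap_eq_smul_one]
    rw [Matrix.mul_smul, Matrix.smul_mul, Matrix.mul_one, h2]
  map_star' x := by
    simp [Matrix.star_eq_conjTranspose, Matrix.conjTranspose_mul, Matrix.mul_assoc]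

lemma card_eq_of_unitary {n m : Type*} [Fintype n] [DecidableEq n] [Fintype m] [DecidableEq m]
    {u : Matrix n m ℂ} (h1 : u * uᴴ = 1) (h2 : uᴴ * u = 1) : Fintype.card n = Fintype.card m := by
  have h := Matrix.trace_mul_comm u uᴴ
  rw [h1, h2, Matrix.trace_one, Matrix.trace_one] at h
  exact_mod_cast h

/-! ### Refilling one hole -/

section Hole

variable {L D : ℕ}

lemma siteBoundary_subset (S : Finset (Site L)) : siteBoundary S ⊆ S := Finset.filter_subset _ _

/-- By the definition of the boundary, exterior terms can touch a hole only there. -/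
lemma disjoint_plaquette_interior {S : Finset (Site L)} {Z : Plaquette L}
    (hZ : ¬ Plaquette.sites Z ⊆ S) : Disjoint (Plaquette.sites Z) (S \ siteBoundary S) := by
  rw [Finset.disjoint_left]
  intro s hs hs'
  rw [Finset.mem_sdiff] at hs'
  exact hs'.2 (Finset.mem_filter.2 ⟨hs'.1, Z, hs, hZ⟩)

/-- The interior factor of a hole: matrix units on the hole that commute with the exterior terms and
whose corners are one-dimensional for the algebra of the interior terms. -/
lemma exists_hole_units [NeZero D] {Q : Plaquette L → Op (Site L) (Fin D)}
    (hQ : IsCommutingProjectors Q) {S : Finset (Site L)} (hS : BoundaryFactors Q S) :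
    ∃ (κ : Type) (_ : Fintype κ) (_ : DecidableEq κ) (F : κ → κ → Op (Site L) (Fin D)),
      IsMatrixUnits F ∧ (∀ k l, SupportedOn S (F k l)) ∧
      (∀ Z, ¬ Plaquette.sites Z ⊆ S → ∀ k l, Commute (Q Z) (F k l)) ∧
      (∀ r ∈ Algebra.adjoin ℂ {O | ∃ Z, Plaquette.sites Z ⊆ S ∧ O = Q Z},
        ∀ k, ∃ c : ℂ, F k k * r * F k k = c • F k k) ∧
      Nonempty (κ ↪ (S → Fin D)) := by
  obtain ⟨a, b, u, hu1, hu2, hext, hint⟩ := hS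
  set I := S \ siteBoundary S with hI
  have hBS : siteBoundary S ⊆ S := siteBoundary_subset S
  have hIS : I ⊆ S := Finset.sdiff_subset
  have hBI : Disjoint (siteBoundary S) I := Finset.disjoint_sdiff
  let φ : Matrix (Fin a × Fin b) (Fin a × Fin b) ℂ →⋆ₐ[ℂ] Op (Site L) (Fin D) :=
    (extendHom (Fin D) (siteBoundary S)).comp (conjHom u hu1 hu2)
  have hφ : ∀ x, SupportedOn (siteBoundary S) (φ x) := fun x => ⟨uᴴ * x * u, rfl⟩
  have hconj : ∀ M : Op (siteBoundary S) (Fin D), conjHom u hu1 hu2 (u * M * uᴴ) = M := fun M => by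
    change uᴴ * (u * M * uᴴ) * u = M
    have : uᴴ * (u * M * uᴴ) * u = (uᴴ * u) * M * (uᴴ * u) := by simp only [Matrix.mul_assoc]
    rw [this, hu2, Matrix.one_mul, Matrix.mul_one]
  have hkc : ∀ (x : Matrix (Fin a) (Fin a) ℂ) (y : Matrix (Fin b) (Fin b) ℂ),
      Commute (x ⊗ₖ (1 : Matrix (Fin b) (Fin b) ℂ)) ((1 : Matrix (Fin a) (Fin a) ℂ) ⊗ₖ y) := by
    intro x y
    rw [Commute, SemiconjBy, ← Matrix.mul_kronecker_mul, ← Matrix.mul_kronecker_mul]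
    simp
  have hφext : ∀ y : Matrix (Fin b) (Fin b) ℂ, ∀ Z, ¬ Plaquette.sites Z ⊆ S →
      Commute (φ ((1 : Matrix (Fin a) (Fin a) ℂ) ⊗ₖ y)) (Q Z) := by
    intro y Z hZ
    refine commute_of_commute_interactionAlgebra
      (A := Algebra.adjoin ℂ {O | ∃ Z, ¬ Plaquette.sites Z ⊆ S ∧ O = Q Z}) (fun M hM => ?_)
      (Algebra.subset_adjoin ⟨Z, hZ, rfl⟩)
    obtain ⟨x, hx⟩ := hext M hM
    rw [← hconj M, hx]
    exact (hkc x y).symm.map (conjHom u hu1 hu2)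
  have hφint : ∀ x : Matrix (Fin a) (Fin a) ℂ,
      ∀ r ∈ Algebra.adjoin ℂ {O | ∃ Z, Plaquette.sites Z ⊆ S ∧ O = Q Z},
      Commute (φ (x ⊗ₖ (1 : Matrix (Fin b) (Fin b) ℂ))) r := by
    intro x r hr
    refine commute_of_commute_interactionAlgebra (fun M hM => ?_) hr
    obtain ⟨y, hy⟩ := hint M hM
    rw [← hconj M, hy]
    exact (hkc x y).map (conjHom u hu1 hu2)
  -- Matrix units of the factor facing the interior. Together with all operators on the non-boundary
  -- sites of the hole they form the part of the hole that no exterior term sees.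
  let E : Fin b → Fin b → Op (Site L) (Fin D) := fun β β' =>
    φ ((1 : Matrix (Fin a) (Fin a) ℂ) ⊗ₖ Matrix.single β β' 1)
  have hE : IsMatrixUnits E := by
    refine ⟨fun β β' γ γ' => ?_, fun β β' => ?_, ?_⟩
    · simp only [E, ← map_mul, ← Matrix.mul_kronecker_mul, Matrix.one_mul]
      split_ifs with h
      · subst h; simp
      · rw [Matrix.single_mul_single_of_ne _ _ _ _ h, Matrix.kronecker_zero, map_zero]
    · simp only [E, ← map_star, Matrix.star_eq_conjTranspose, Matrix.conjTranspose_kronecker,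
        Matrix.conjTranspose_one, Matrix.conjTranspose_single, star_one]
    · have h : ∑ β : Fin b, (1 : Matrix (Fin a) (Fin a) ℂ) ⊗ₖ Matrix.single β β (1 : ℂ) = 1 := by
        ext ⟨i, β⟩ ⟨j, γ⟩
        by_cases h1 : i = j <;> by_cases h2 : β = γ <;>
          simp [Matrix.sum_apply, Matrix.kroneckerMap_apply, Matrix.one_apply, Matrix.single_apply,
            h1, h2]
      simp only [E, ← map_sum, h, map_one]
  have hEI : ∀ β β' y y', Commute (E β β') (unitOn I y y') := fun β β' y y' =>
    (hφ _).commute hBI (unitOn_supportedOn I y y')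
  have hF := hE.prod (unitOn_isMatrixUnits (α := Fin D) I) hEI
  set F := fun k l : Fin b × (I → Fin D) => E k.1 l.1 * unitOn I k.2 l.2 with hFdef
  have hFS : ∀ k l, SupportedOn S (F k l) := fun k l =>
    ((hφ _).mono hBS).mul ((unitOn_supportedOn I _ _).mono hIS)
  refine ⟨Fin b × (I → Fin D), inferInstance, inferInstance, F, hF, hFS, ?_, ?_, ?_⟩
  · intro Z hZ k l
    refine Commute.mul_right (hφext _ Z hZ).symm ?_
    exact (hQ.supported Z).commute (disjoint_plaquette_interior hZ) (unitOn_supportedOn I _ _)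
  · intro r hr k
    have hrS : SupportedOn S r := by
      refine mem_supportAlgebra.1 (Algebra.adjoin_le ?_ hr)
      rintro _ ⟨Z, hZ, rfl⟩
      exact mem_supportAlgebra.2 ((hQ.supported Z).mono hZ)
    -- The component commutes with everything, hence is a scalar. Operators on the boundary are
    -- generated by the interior factor, which lies in the span of `F`, and the exterior factor,
    -- which commutes with `r` and `F`. Non-boundary sites of `S` are covered by `F`, and outside
    -- `S` the supports are disjoint.
    have hX : SupportedOn ∅ (component F r k k) := by
      refine supportedOn_of_commute_site fun v _ K hK => ?_
      by_cases hv : v ∈ S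
      · by_cases hvB : v ∈ siteBoundary S
        · obtain ⟨M, rfl⟩ := hK.mono (Finset.singleton_subset_iff.2 hvB)
          have h1 : ∀ β β', Commute (component F r k k) (E β β') := by
            intro β β'
            have : E β β' = ∑ y, F (β, y) (β', y) := by
              simp only [hFdef, ← Finset.mul_sum, sum_unitOn, mul_one]
            rw [this]
            exact Commute.sum_right _ _ _ fun y _ => hF.component_commute _ _ _ _ _
          have h2 : ∀ x : Matrix (Fin a) (Fin a) ℂ,
              Commute (component F r k k) (φ (x ⊗ₖ (1 : Matrix (Fin b) (Fin b) ℂ))) := fun x =>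
            component_commute_of_commute (hφint x r hr).symm (fun l m =>
              Commute.mul_left ((hkc x _).symm.map φ)
                ((hφ _).commute hBI (unitOn_supportedOn I _ _)).symm) k k
          have h3 : extendOp (siteBoundary S) M = φ (u * M * uᴴ) := by
            change _ = extendOp (siteBoundary S) (conjHom u hu1 hu2 (u * M * uᴴ))
            rw [hconj]
          have h4 : u * M * uᴴ = ∑ i : Fin a × Fin b, ∑ j : Fin a × Fin b,
              (u * M * uᴴ) i j • ((Matrix.single i.1 j.1 1 ⊗ₖ (1 : Matrix (Fin b) (Fin b) ℂ)) *
                ((1 : Matrix (Fin a) (Fin a) ℂ) ⊗ₖ Matrix.single i.2 j.2 1)) := by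
            conv_lhs => rw [Matrix.matrix_eq_sum_single (u * M * uᴴ)]
            refine Finset.sum_congr rfl fun i _ => Finset.sum_congr rfl fun j _ => ?_
            rw [← Matrix.mul_kronecker_mul, Matrix.mul_one, Matrix.one_mul,
              Matrix.single_kronecker_single, Matrix.smul_single]
            simp
          rw [h3, h4]
          simp only [map_sum, map_smul, map_mul]
          exact Commute.sum_right _ _ _ fun i _ => Commute.sum_right _ _ _ fun j _ =>
            ((h2 _).mul_right (h1 _ _)).smul_right _
        · have hvI : v ∈ I := Finset.mem_sdiff.2 ⟨hv, hvB⟩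
          refine ((hK.mono (Finset.singleton_subset_iff.2 hvI)).commute_of_units
            fun y y' => ?_).symm
          have : unitOn I y y' = ∑ β, F (β, y) (β, y') := by
            simp only [hFdef, ← Finset.sum_mul, hE.sum, one_mul]
          rw [this]
          exact (Commute.sum_right _ _ _ fun y _ => hF.component_commute _ _ _ _ _).symm
      · have hd : Disjoint S {v} := Finset.disjoint_singleton_right.2 hv
        exact component_commute_of_commute (hrS.commute hd hK)
          (fun l m => (hFS l m).commute hd hK) k k
    obtain ⟨c, hc⟩ := hX.eq_smul_one
    exact ⟨c, by rw [← hF.component_mul, hc, smul_mul_assoc, one_mul]⟩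
  · refine Function.Embedding.nonempty_of_card_le ?_
    have hcard := card_eq_of_unitary hu1 hu2
    have hpos : 0 < Fintype.card (siteBoundary S → Fin D) := Fintype.card_pos
    rw [Fintype.card_prod, Fintype.card_fin, Fintype.card_fin] at hcard
    have ha : 0 < a := by
      rcases Nat.eq_zero_or_pos a with h | h
      · rw [h, zero_mul] at hcard
        omega
      · exact h
    have hsum : S.card = (siteBoundary S).card + I.card := by
      rw [hI, Finset.card_sdiff_of_subset hBS]
      have := Finset.card_le_card hBS
      omega
    calc Fintype.card (Fin b × (I → Fin D)) = b * D ^ I.card := by simp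
      _ ≤ (a * b) * D ^ I.card := Nat.mul_le_mul_right _ (Nat.le_mul_of_pos_left b ha)
      _ = Fintype.card (S → Fin D) := by
        rw [hcard]
        simp [hsum, pow_add]

/-- A gate on a hole, with its ancillas, that takes every state in which the ancillas of the hole are
in a fixed basis state to a state fixed by a given projection of the interior algebra. The gate
commutes with the exterior terms. -/
lemma exists_hole_gate [NeZero D] {Q : Plaquette L → Op (Site L) (Fin D)}
    (hQ : IsCommutingProjectors Q) {S : Finset (Site L)} (hS : BoundaryFactors Q S)
    {r : Op (Site L) (Fin D)} (hr : IsStarProjection r) (hr0 : r ≠ 0)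
    (hrA : r ∈ Algebra.adjoin ℂ {O | ∃ Z, Plaquette.sites Z ⊆ S ∧ O = Q Z}) :
    ∃ (τ : S → Fin D) (T : Op (Site L) (Fin D × Fin D)),
      T ∈ Matrix.unitaryGroup (Site L → Fin D × Fin D) ℂ ∧ SupportedOn S T ∧
      (∀ Z, ¬ Plaquette.sites Z ⊆ S → Commute (withAncilla (Q Z)) T) ∧
      ∀ Ψ, ancillaHom L D (unitOn S τ τ) *ᵥ Ψ = Ψ → withAncilla r *ᵥ (T *ᵥ Ψ) = T *ᵥ Ψ := by
  obtain ⟨κ, _, _, F, hF, hFS, hFext, hFint, ⟨f⟩⟩ := exists_hole_units hQ hS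
  obtain ⟨k, hk⟩ : ∃ k, r * F k k ≠ 0 := by
    by_contra! h
    apply hr0
    rw [← mul_one r, ← hF.sum, Finset.mul_sum]
    exact Finset.sum_eq_zero fun k _ => h k
  have hFk : IsStarProjection (F k k) :=
    ⟨by rw [IsIdempotentElem, hF.mul, if_pos rfl], hF.star_eq k k⟩
  obtain ⟨c, hc⟩ := hFint r hrA k
  -- Rotating inside the algebra generated by `F k k` and `r` keeps the gate supported on the hole
  -- and commuting with the exterior terms.
  obtain ⟨U, hUA, hUU, hrU⟩ := exists_unitary_rotation (Algebra.adjoin ℂ {F k k, r}) hFk hr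
    (Algebra.subset_adjoin (by simp)) (Algebra.subset_adjoin (by simp)) hc hk
  have hrS : SupportedOn S r := by
    refine mem_supportAlgebra.1 (Algebra.adjoin_le ?_ hrA)
    rintro _ ⟨Z, hZ, rfl⟩
    exact mem_supportAlgebra.2 ((hQ.supported Z).mono hZ)
  have hUS : SupportedOn S U := by
    refine mem_supportAlgebra.1 (Algebra.adjoin_le ?_ hUA)
    rintro x (rfl | rfl)
    · exact mem_supportAlgebra.2 (hFS k k)
    · exact mem_supportAlgebra.2 hrS
  have hQr : ∀ Z, Commute (Q Z) r := fun Z =>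
    Algebra.commute_of_mem_adjoin_of_forall_mem_commute hrA (by
      rintro _ ⟨Y, -, rfl⟩
      exact hQ.commute Z Y)
  have hQU : ∀ Z, ¬ Plaquette.sites Z ⊆ S → Commute (Q Z) U := fun Z hZ =>
    Algebra.commute_of_mem_adjoin_of_forall_mem_commute hUA (by
      rintro x (rfl | rfl)
      · exact hFext Z hZ k k
      · exact hQr Z)
  have hF' : IsMatrixUnits fun k l => realHom L D (F k l) := by
    refine ⟨fun a b c d => ?_, fun a b => ?_, ?_⟩
    · rw [← map_mul, hF.mul]
      split_ifs <;> simp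
    · rw [← map_star, hF.star_eq]
    · rw [← map_sum, hF.sum, map_one]
  obtain ⟨W, hWA, hWU, hWc, hW⟩ := exists_exchange hF'
    (G := fun k l => ancillaHom L D (unitOn S (f k) (f l)))
    (fun a b c d => by
      rw [← map_mul, unitOn_mul]
      simp only [f.injective.eq_iff]
      split_ifs <;> simp)
    (fun a b => by rw [← map_star, unitOn_star])
    (fun a b c d => realHom_commute_ancillaHom _ _)
    (supportAlgebra (Fin D × Fin D) S)
    (fun a b => mem_supportAlgebra.2 (supportedOn_realHom (hFS a b)))
    fun a b => mem_supportAlgebra.2 (supportedOn_ancillaHom (unitOn_supportedOn _ _ _))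
  -- The exchange `W` acts first: ancillas in the state `f k` put the hole into the range of `F k
  -- k`, and `U` then takes it into the range of `r`.
  refine ⟨f k, realHom L D U * W, mul_mem (realHom_mem_unitaryGroup hUU) hWU,
    (supportedOn_realHom hUS).mul (mem_supportAlgebra.1 hWA), fun Z hZ => ?_, fun Ψ hΨ => ?_⟩
  · exact ((hQU Z hZ).map (realHom L D)).mul_right
      (hWc _ (fun a b => (hFext Z hZ a b).map (realHom L D))
        fun a b => realHom_commute_ancillaHom _ _)
  · have key : realHom L D r * (realHom L D U * W * ancillaHom L D (unitOn S (f k) (f k))) =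
        realHom L D U * W * ancillaHom L D (unitOn S (f k) (f k)) := by
      have h1 := congrArg (realHom L D) hrU
      simp only [map_mul] at h1
      rw [mul_assoc, ← hW k, ← mul_assoc (realHom L D U), ← mul_assoc, h1]
    rw [← hΨ, Matrix.mulVec_mulVec (M := realHom L D U * W), ← realHom_apply,
      Matrix.mulVec_mulVec, key]

end Hole

/-! ### Dividing the lattice into cells -/

section Geometry

/-- Selecting every `K`-th point of an arithmetic progression and dividing the line into strips
around the selected points. -/
lemma exists_strips {m : ℕ} (hm : 0 < m) {C o r : ℝ} (hC : 1 ≤ C) (hr : 0 < r) (hrC : r ≤ C) :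
    ∃ (d : ℝ) (A : ℕ → ℕ) (I : ℕ → Fin m), 0 < d ∧ d ≤ 11 * C ∧ (∀ x, A x < m) ∧
      (∀ x, A (x + 1) ≠ A x → A (x + 1) = A x + 1 ∧
        (∀ z : ℝ, |z - (o + r * (I (A x)).val)| ≤ C → z < x) ∧
        ∀ z : ℝ, |z - (o + r * (I (A (x + 1))).val)| ≤ C → (x : ℝ) + 1 < z) ∧
      ∀ x : ℕ, (∃ i < m, |(x : ℝ) - (o + r * (i : ℝ))| ≤ C) →
        |(x : ℝ) - (o + d * (A x : ℝ))| ≤ d + C := by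
  -- The selected points have spacing d between 10C and 11C, so the dividing lines of the strips are
  -- at least 5C from them. This leaves room for a hole at distance C and for a lattice step.
  set K := ⌈10 * C / r⌉₊ with hK
  set d := r * K with hd
  have hd10 : 10 * C ≤ d := by
    have := Nat.le_ceil (10 * C / r)
    rw [div_le_iff₀ hr] at this
    linarith
  have hd11 : d ≤ 11 * C := by
    have := Nat.ceil_lt_add_one (show 0 ≤ 10 * C / r by positivity)
    have h2 : r * (10 * C / r + 1) = 10 * C + r := by field_simp
    nlinarith
  have hd0 : 0 < d := by linarith
  have hK0 : 0 < K := by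
    rcases Nat.eq_zero_or_pos K with h | h
    · rw [hd, h] at hd0
      simp at hd0
    · exact h
  set M := (m - 1) / K with hM
  have hKM : K * M ≤ m - 1 := Nat.mul_div_le _ _
  have hKM' : m - 1 < K * (M + 1) := Nat.lt_mul_div_succ _ hK0
  -- Index of the nearest selected point. The natural-number floor truncates on the left, and the
  -- minimum with `M`, the last selected index, truncates on the right.
  let fl : ℕ → ℕ := fun x => ⌊((x : ℝ) - o) / d + 1 / 2⌋₊
  let A : ℕ → ℕ := fun x => min M (fl x)
  have hAM : ∀ x, A x ≤ M := fun x => min_le_left _ _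
  have hMK : M ≤ K * M := Nat.le_mul_of_pos_left M hK0
  have hKA : ∀ x, K * A x < m := fun x => by
    have := Nat.mul_le_mul_left K (hAM x)
    omega
  -- The default 0 is never reached at an index of the form `A x`.
  let I : ℕ → Fin m := fun a => if h : K * a < m then ⟨K * a, h⟩ else ⟨0, hm⟩
  have hI : ∀ x, r * ((I (A x)).val : ℝ) = d * A x := fun x => by
    simp only [I, dif_pos (hKA x), Nat.cast_mul, hd]
    ring
  have hfl : ∀ x, fl x ≤ fl (x + 1) ∧ fl (x + 1) ≤ fl x + 1 := by
    intro x
    have h1 : ((x + 1 : ℕ) : ℝ) = x + 1 := by push_cast; ring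
    have h2 : (((x + 1 : ℕ) : ℝ) - o) / d + 1 / 2 = ((x : ℝ) - o) / d + 1 / 2 + 1 / d := by
      rw [h1]
      field_simp
      ring
    have h3 : 0 < 1 / d := by positivity
    have h4 : 1 / d ≤ 1 := by
      rw [div_le_one hd0]
      linarith
    refine ⟨Nat.floor_mono (by rw [h2]; linarith), ?_⟩
    have h5 : ((x : ℝ) - o) / d + 1 / 2 < fl x + 1 := Nat.lt_floor_add_one _
    have h6 : fl (x + 1) < fl x + 2 := by
      have : (0 : ℝ) ≤ fl x := Nat.cast_nonneg _
      refine (Nat.floor_lt' (by omega)).2 ?_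
      rw [h2]
      push_cast
      linarith
    omega
  refine ⟨d, A, I, hd0, hd11, fun x => by have := hAM x; omega, fun x hne => ?_, fun x hx => ?_⟩
  · obtain ⟨h1, h2⟩ := hfl x
    have hA : A (x + 1) = A x + 1 ∧ A x = fl x ∧ fl (x + 1) = fl x + 1 := by
      simp only [A] at hne ⊢
      omega
    refine ⟨hA.1, ?_⟩
    rw [hI, hI, hA.1]
    have h3 : ((x : ℝ) - o) / d + 1 / 2 < A x + 1 := by
      rw [hA.2.1]
      exact Nat.lt_floor_add_one _
    have h4 : ((A x : ℝ) + 1) ≤ (((x + 1 : ℕ) : ℝ) - o) / d + 1 / 2 := by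
      have := (Nat.le_floor_iff' (by omega)).1 hA.2.2.ge
      rw [hA.2.1]
      exact_mod_cast this
    have h3' : (x : ℝ) - o < (A x + 1 / 2) * d := by
      rw [← div_lt_iff₀ hd0]
      linarith
    have h4' : (A x + 1 / 2) * d ≤ ((x : ℝ) + 1) - o := by
      rw [← le_div_iff₀ hd0]
      push_cast at h4
      linarith
    refine ⟨fun z hz => ?_, fun z hz => ?_⟩
    · rw [abs_le] at hz
      nlinarith
    · rw [abs_le] at hz
      push_cast at hz
      nlinarith
  · obtain ⟨i, hi, hxi⟩ := hx
    rw [abs_le] at hxi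
    have hi0 : 0 ≤ r * (i : ℝ) := by positivity
    have hi1 : r * (i : ℝ) ≤ d * (M + 1) := by
      have : (i : ℝ) ≤ K * (M + 1) := by
        have : i ≤ K * (M + 1) := by omega
        exact_mod_cast this
      rw [hd, mul_assoc]
      exact mul_le_mul_of_nonneg_left this hr.le
    set z := ((x : ℝ) - o) / d + 1 / 2 with hz
    have hzx : (x : ℝ) - o = (z - 1 / 2) * d := by
      rw [hz]
      field_simp
      ring
    have hflx : fl x = ⌊z⌋₊ := rfl
    rw [abs_le]
    rcases lt_or_ge z 0 with h0 | h0
    · have : A x = 0 := by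
        simp [A, hflx, Nat.floor_of_nonpos h0.le]
      rw [this]
      push_cast
      constructor <;> nlinarith
    · have h1 := Nat.floor_le h0
      have h2 := Nat.lt_floor_add_one z
      rw [← hflx] at h1 h2
      rcases le_or_gt (fl x) M with h | h
      · have : A x = fl x := min_eq_right h
        rw [this]
        constructor <;> nlinarith
      · have : A x = M := min_eq_left h.le
        rw [this]
        have h3 : ((M : ℝ) + 1) ≤ fl x := by exact_mod_cast h
        constructor <;> nlinarith

/-- The cells meet in pairs outside of the plaquettes `P`: strips in both directions divide the
lattice into tiles, and the plaquette `P a b` divides the tile `(a, b)` into quadrants. -/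
lemma cells_of_plaquette {A B : ℕ → ℕ} {P : ℕ → ℕ → ℕ × ℕ} {x y : ℕ}
    (hA : A (x + 1) ≠ A x → A (x + 1) = A x + 1 ∧ (∀ b, (P (A x) b).1 < x) ∧
      ∀ b, x + 1 < (P (A (x + 1)) b).1)
    (hB : B (y + 1) ≠ B y → B (y + 1) = B y + 1 ∧ (∀ a, (P a (B y)).2 < y) ∧
      ∀ a, y + 1 < (P a (B (y + 1))).2)
    (hP : ∀ a b, P a b ≠ (x, y)) :
    ∃ p q, p ≤ A x + 1 ∧ q ≤ B y + 1 ∧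
      ((∀ x' y', (x' = x ∨ x' = x + 1) → (y' = y ∨ y' = y + 1) →
        A x' + (if (P (A x') (B y')).1 < x' then 1 else 0) = p ∧
        (B y' + (if (P (A x') (B y')).2 < y' then 1 else 0) = q ∨
          B y' + (if (P (A x') (B y')).2 < y' then 1 else 0) = q + 1)) ∨
      (∀ x' y', (x' = x ∨ x' = x + 1) → (y' = y ∨ y' = y + 1) →
        B y' + (if (P (A x') (B y')).2 < y' then 1 else 0) = q ∧
        (A x' + (if (P (A x') (B y')).1 < x' then 1 else 0) = p ∨
          A x' + (if (P (A x') (B y')).1 < x' then 1 else 0) = p + 1))) := by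
  -- Across a strip boundary the jump of `A` is compensated by the indicator, which drops from 1 to
  -- 0. So this coordinate of the cell does not change, and quadrants of adjacent tiles merge into
  -- one cell.
  have hα : A (x + 1) ≠ A x → ∀ x' b, (x' = x ∨ x' = x + 1) →
      A x' + (if (P (A x') b).1 < x' then 1 else 0) = A x + 1 := by
    rintro h x' b (rfl | rfl)
    · rw [if_pos ((hA h).2.1 b)]
    · rw [if_neg (not_lt.2 ((hA h).2.2 b).le), (hA h).1]
  have hβ : B (y + 1) ≠ B y → ∀ y' a, (y' = y ∨ y' = y + 1) →
      B y' + (if (P a (B y')).2 < y' then 1 else 0) = B y + 1 := by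
    rintro h y' a (rfl | rfl)
    · rw [if_pos ((hB h).2.1 a)]
    · rw [if_neg (not_lt.2 ((hB h).2.2 a).le), (hB h).1]
  by_cases h1 : A (x + 1) = A x
  · have hA' : ∀ x', (x' = x ∨ x' = x + 1) → A x' = A x := by
      rintro x' (rfl | rfl)
      · rfl
      · exact h1
    by_cases h2 : B (y + 1) = B y
    · have hB' : ∀ y', (y' = y ∨ y' = y + 1) → B y' = B y := by
        rintro y' (rfl | rfl)
        · rfl
        · exact h2
      -- Inside a tile, both dividing lines cross a plaquette only if it is `P`. Any other plaquette
      -- sees a change in at most one coordinate.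
      by_cases h3 : (P (A x) (B y)).1 = x
      · have h4 : (P (A x) (B y)).2 ≠ y := fun h4 => hP _ _ (Prod.ext h3 h4)
        refine ⟨A x, B y + (if (P (A x) (B y)).2 < y then 1 else 0), by omega, by split_ifs <;> omega,
          Or.inr fun x' y' hx hy => ?_⟩
        rw [hA' x' hx, hB' y' hy]
        split_ifs <;> omega
      · refine ⟨A x + (if (P (A x) (B y)).1 < x then 1 else 0), B y, by split_ifs <;> omega, by omega,
          Or.inl fun x' y' hx hy => ?_⟩
        rw [hA' x' hx, hB' y' hy]
        split_ifs <;> omega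
    · refine ⟨A x, B y + 1, by omega, le_rfl, Or.inr fun x' y' hx hy => ⟨hβ h2 y' _ hy, ?_⟩⟩
      rw [hA' x' hx]
      split_ifs <;> omega
  · by_cases h2 : B (y + 1) = B y
    · have hB' : ∀ y', (y' = y ∨ y' = y + 1) → B y' = B y := by
        rintro y' (rfl | rfl)
        · rfl
        · exact h2
      refine ⟨A x + 1, B y, le_rfl, by omega, Or.inl fun x' y' hx hy => ⟨hα h1 x' _ hx, ?_⟩⟩
      rw [hB' y' hy]
      split_ifs <;> omega
    · exact ⟨A x + 1, B y + 1, le_rfl, le_rfl,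
        Or.inl fun x' y' hx hy => ⟨hα h1 x' _ hx, Or.inl (hβ h2 y' _ hy)⟩⟩

/-- Two cells whose coordinates differ by at most `k`. -/
def CellsWithin {M N : ℕ} (k : ℕ) (i j : Fin M × Fin N) : Prop :=
  i.1.val ≤ j.1.val + k ∧ j.1.val ≤ i.1.val + k ∧ i.2.val ≤ j.2.val + k ∧ j.2.val ≤ i.2.val + k

/-- A chessboard colouring of the cells. -/
def IsWhite {M N : ℕ} (i : Fin M × Fin N) : Prop := Even (i.1.val + i.2.val)

/-- A cell gathers the quadrants around a common tile corner. Four cells can meet only at the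
plaquette chosen inside a kept hole, since along tile edges the dividing lines of the adjacent tiles
cut in one direction only. Neighbouring cells have opposite chessboard colours. -/
lemma exists_cells {L m n C : ℕ} {S : Fin m × Fin n → Finset (Site L)} (hS : IsHoles S)
    (hC : FormSquareLattice C S) :
    ∃ (J : Finset (Fin m × Fin n)) (cell : Site L → Fin (m + 2) × Fin (n + 2)),
      (∀ Z : Plaquette L, (∀ i ∈ J, ¬ Plaquette.sites Z ⊆ S i) → ∃ b w,
        Plaquette.sites Z ⊆ cellSites cell b ∪ cellSites cell w ∧
        (b = w ∨ (IsWhite w ∧ ¬ IsWhite b)) ∧ CellsWithin 1 b w) ∧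
      ∀ s t, CellsWithin 2 (cell s) (cell t) →
        dist (Site.pos s) (Site.pos t) ≤ ((68 * C : ℕ) : ℝ) := by
  classical
  obtain ⟨c, o, r, hr, hrC, hc, -, hSc, hcov⟩ := hC
  rcases Nat.eq_zero_or_pos L with rfl | hL
  · exact ⟨∅, fun s => s.1.elim0, fun Z => Z.1.elim0, fun s => s.1.elim0⟩
  have hC1 : (1 : ℝ) ≤ C := by
    have : (0 : ℝ) < C := hr.trans_le hrC
    have : 0 < C := by exact_mod_cast this
    exact_mod_cast this
  obtain ⟨i₀, -⟩ := hcov (⟨0, hL⟩, ⟨0, hL⟩)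
  obtain ⟨d, A, I, hd, hd11, hAm, hA, hAc⟩ :=
    exists_strips (o := o.1) i₀.1.pos hC1 hr hrC
  obtain ⟨e, B, I', he, he11, hBn, hB, hBc⟩ :=
    exists_strips (o := o.2) i₀.2.pos hC1 hr hrC
  choose P hP using hS.plaquette
  let p : ℕ → ℕ → ℕ × ℕ := fun a b => ((P (I a, I' b)).1.val, (P (I a, I' b)).2.val)
  have hp : ∀ a b, |((p a b).1 : ℝ) - (o.1 + r * (I a).val)| ≤ C ∧
      |((p a b).2 : ℝ) - (o.2 + r * (I' b).val)| ≤ C := by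
    intro a b
    have h1 : ((⟨(p a b).1, by have := (P (I a, I' b)).1.2; simp only [p]; omega⟩,
        ⟨(p a b).2, by have := (P (I a, I' b)).2.2; simp only [p]; omega⟩) : Site L) ∈
        S (I a, I' b) := hP _ (by simp [Plaquette.sites, p])
    have h2 := hSc _ _ h1
    rw [hc, Prod.dist_eq, max_le_iff, Real.dist_eq, Real.dist_eq] at h2
    exact h2
  let cx : Site L → ℕ := fun s =>
    A s.1.val + if (p (A s.1.val) (B s.2.val)).1 < s.1.val then 1 else 0
  let cy : Site L → ℕ := fun s =>
    B s.2.val + if (p (A s.1.val) (B s.2.val)).2 < s.2.val then 1 else 0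
  have hcx : ∀ s, A s.1.val ≤ cx s ∧ cx s ≤ A s.1.val + 1 := fun s => by
    simp only [cx]
    split_ifs <;> omega
  have hcy : ∀ s, B s.2.val ≤ cy s ∧ cy s ≤ B s.2.val + 1 := fun s => by
    simp only [cy]
    split_ifs <;> omega
  let cell : Site L → Fin (m + 2) × Fin (n + 2) := fun s =>
    (⟨cx s, by have := hcx s; have := hAm s.1.val; omega⟩,
      ⟨cy s, by have := hcy s; have := hBn s.2.val; omega⟩)
  refine ⟨Finset.univ.filter fun i => ∃ a b, i = (I a, I' b), cell, fun Z hZ => ?_,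
    fun s t hst => ?_⟩
  · obtain ⟨u, v, hu, hv, h⟩ := cells_of_plaquette (A := A) (B := B) (P := p) (x := Z.1.val)
      (y := Z.2.val)
      (fun h => ⟨(hA _ h).1, fun b => by exact_mod_cast (hA _ h).2.1 _ (hp _ b).1,
        fun b => by exact_mod_cast (hA _ h).2.2 _ (hp _ b).1⟩)
      (fun h => ⟨(hB _ h).1, fun a => by exact_mod_cast (hB _ h).2.1 _ (hp a _).2,
        fun a => by exact_mod_cast (hB _ h).2.2 _ (hp a _).2⟩)
      (fun a b hab => by
        refine hZ (I a, I' b) (by simp) ?_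
        have : Z = P (I a, I' b) :=
          Prod.ext (Fin.ext (Prod.ext_iff.1 hab).1.symm) (Fin.ext (Prod.ext_iff.1 hab).2.symm)
        rw [this]
        exact hP _)
    have hum : u + 1 < m + 2 := by have := hAm Z.1.val; omega
    have hvn : v + 1 < n + 2 := by have := hBn Z.2.val; omega
    have key : ∀ i j : Fin (m + 2) × Fin (n + 2),
        (∀ s ∈ Plaquette.sites Z, cell s = i ∨ cell s = j) →
        (i.1.val = j.1.val ∧ j.2.val = i.2.val + 1 ∨ i.2.val = j.2.val ∧ j.1.val = i.1.val + 1) →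
        ∃ b w, Plaquette.sites Z ⊆ cellSites cell b ∪ cellSites cell w ∧
          (b = w ∨ (IsWhite w ∧ ¬ IsWhite b)) ∧ CellsWithin 1 b w := by
      intro i j hs hij
      have hsub : Plaquette.sites Z ⊆ cellSites cell i ∪ cellSites cell j := fun s hs' => by
        simpa [mem_cellSites] using hs s hs'
      by_cases hi : IsWhite i
      · refine ⟨j, i, by rwa [Finset.union_comm], Or.inr ⟨hi, ?_⟩, ?_⟩
        · simp only [IsWhite, Nat.even_iff] at hi ⊢
          omega
        · simp only [CellsWithin]
          omega
      · refine ⟨i, j, hsub, Or.inr ⟨?_, hi⟩, ?_⟩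
        · simp only [IsWhite, Nat.even_iff] at hi ⊢
          omega
        · simp only [CellsWithin]
          omega
    rcases h with h | h
    · refine key (⟨u, by omega⟩, ⟨v, by omega⟩) (⟨u, by omega⟩, ⟨v + 1, hvn⟩) (fun s hs => ?_)
        (Or.inl ⟨rfl, rfl⟩)
      have hs' := (Finset.mem_filter.1 hs).2
      obtain ⟨h1, h2⟩ := h s.1.val s.2.val hs'.1 hs'.2
      exact h2.imp (fun h2 => Prod.ext (Fin.ext h1) (Fin.ext h2))
        fun h2 => Prod.ext (Fin.ext h1) (Fin.ext h2)
    · refine key (⟨u, by omega⟩, ⟨v, by omega⟩) (⟨u + 1, hum⟩, ⟨v, by omega⟩) (fun s hs => ?_)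
        (Or.inr ⟨rfl, rfl⟩)
      have hs' := (Finset.mem_filter.1 hs).2
      obtain ⟨h1, h2⟩ := h s.1.val s.2.val hs'.1 hs'.2
      exact h2.imp (fun h2 => Prod.ext (Fin.ext h2) (Fin.ext h1))
        fun h2 => Prod.ext (Fin.ext h2) (Fin.ext h1)
  · have hnear : ∀ s : Site L, |(s.1.val : ℝ) - (o.1 + d * (A s.1.val : ℝ))| ≤ d + C ∧
        |(s.2.val : ℝ) - (o.2 + e * (B s.2.val : ℝ))| ≤ e + C := by
      intro s
      obtain ⟨i, hi⟩ := hcov s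
      rw [hc, Prod.dist_eq, max_le_iff, Real.dist_eq, Real.dist_eq] at hi
      exact ⟨hAc _ ⟨i.1.val, i.1.2, hi.1⟩, hBc _ ⟨i.2.val, i.2.2, hi.2⟩⟩
    -- Cell coordinates differ by at most 2, so strip indices differ by at most 3, and the distance
    -- is at most 5d + 2C ≤ 57C. The constant 68 leaves slack.
    have hline : ∀ {o d x x' : ℝ} {a a' : ℕ}, 0 < d → d ≤ 11 * C → |x - (o + d * a)| ≤ d + C →
        |x' - (o + d * a')| ≤ d + C → a ≤ a' + 3 → a' ≤ a + 3 → |x - x'| ≤ 68 * C := by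
      intro o d x x' a a' hd hd11 h1 h2 h3 h4
      have h3' : (a : ℝ) ≤ a' + 3 := by exact_mod_cast h3
      have h4' : (a' : ℝ) ≤ a + 3 := by exact_mod_cast h4
      rw [abs_le] at h1 h2 ⊢
      constructor <;> nlinarith
    have hst' : cx s ≤ cx t + 2 ∧ cx t ≤ cx s + 2 ∧ cy s ≤ cy t + 2 ∧ cy t ≤ cy s + 2 := hst
    have h1 := hcx s
    have h2 := hcx t
    have h3 := hcy s
    have h4 := hcy t
    rw [Prod.dist_eq, max_le_iff, Real.dist_eq, Real.dist_eq]
    push_cast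
    exact ⟨hline hd hd11 (hnear s).1 (hnear t).1 (by omega) (by omega),
      hline he he11 (hnear s).2 (hnear t).2 (by omega) (by omega)⟩

end Geometry

/-! ### Least energy and joint eigenvectors -/

section GroundState

/-- A Hermitian matrix has a least eigenvalue. -/
lemma Matrix.IsHermitian.exists_least_eigenvalue {N : Type*} [Fintype N] [DecidableEq N] [Nonempty N]
    {H : Matrix N N ℂ} (hH : H.IsHermitian) :
    ∃ (l : ℝ) (v : N → ℂ) (B : Matrix N N ℂ), v ≠ 0 ∧ H *ᵥ v = (l : ℂ) • v ∧
      H = (l : ℂ) • 1 + star B * B := by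
  obtain ⟨i, hi⟩ := Finite.exists_min hH.eigenvalues
  set u : Matrix N N ℂ := hH.eigenvectorUnitary.1 with hu
  set w : N → ℂ := fun j => (√(hH.eigenvalues j - hH.eigenvalues i) : ℝ) with hw
  have huu : u * star u = 1 := (Matrix.mem_unitaryGroup_iff).1 hH.eigenvectorUnitary.2
  refine ⟨hH.eigenvalues i, hH.eigenvectorBasis i, Matrix.diagonal w * star u, ?_, ?_, ?_⟩
  · intro h
    have h1 := hH.eigenvectorBasis.orthonormal.ne_zero i
    exact h1 (by ext j; exact congrFun h j)
  · exact hH.mulVec_eigenvectorBasis i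
  · have h1 : star (Matrix.diagonal w) * Matrix.diagonal w =
        Matrix.diagonal (fun j => (hH.eigenvalues j : ℂ)) - (hH.eigenvalues i : ℂ) • 1 := by
      rw [Matrix.star_eq_conjTranspose, Matrix.diagonal_conjTranspose,
        Matrix.diagonal_mul_diagonal, Matrix.smul_one_eq_diagonal, Matrix.diagonal_sub]
      congr 1
      funext j
      have h2 : star (w j) = w j := Complex.conj_ofReal _
      rw [Pi.star_apply, h2, hw, ← Complex.ofReal_mul, Real.mul_self_sqrt (sub_nonneg.2 (hi j)),
        Complex.ofReal_sub]
    have h2 : H = u * Matrix.diagonal (fun j => (hH.eigenvalues j : ℂ)) * star u :=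
      hH.spectral_theorem
    have h3 : star (Matrix.diagonal w * star u) * (Matrix.diagonal w * star u) =
        u * (star (Matrix.diagonal w) * Matrix.diagonal w) * star u := by
      rw [star_mul, star_star]
      simp only [mul_assoc]
    rw [h3, h1, mul_sub, sub_mul, ← h2, mul_smul_comm, mul_one, smul_mul_assoc, huu]
    abel

variable {L D : ℕ} {Q : Plaquette L → Op (Site L) (Fin D)}

/-- The least eigenvalue of the Hamiltonian has an eigenvector that is an eigenvector of every
term. -/
lemma IsCommutingProjectors.exists_joint_eigenvector [NeZero D] (hQ : IsCommutingProjectors Q) :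
    ∃ (l : ℝ) (v : (Site L → Fin D) → ℂ) (B : Op (Site L) (Fin D)), v ≠ 0 ∧
      hamiltonian Q *ᵥ v = (l : ℂ) • v ∧ (∀ Z, Q Z *ᵥ v = v ∨ Q Z *ᵥ v = 0) ∧
      hamiltonian Q = (l : ℂ) • 1 + star B * B := by
  have hH : (hamiltonian Q).IsHermitian := by
    rw [Matrix.IsHermitian, hamiltonian, Matrix.conjTranspose_sum]
    exact Finset.sum_congr rfl fun Z _ => hQ.hermitian Z
  obtain ⟨l, v, B, hv, hHv, hB⟩ := hH.exists_least_eigenvalue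
  suffices h : ∀ T : Finset (Plaquette L), ∃ v : (Site L → Fin D) → ℂ, v ≠ 0 ∧
      hamiltonian Q *ᵥ v = (l : ℂ) • v ∧ ∀ Z ∈ T, Q Z *ᵥ v = v ∨ Q Z *ᵥ v = 0 by
    obtain ⟨v, h1, h2, h3⟩ := h Finset.univ
    exact ⟨l, v, B, h1, h2, fun Z => h3 Z (Finset.mem_univ Z), hB⟩
  intro T
  induction T using Finset.induction_on with
  | empty => exact ⟨v, hv, hHv, by simp⟩
  | insert Y T _ ih =>
    obtain ⟨v, hv, hHv, hT⟩ := ih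
    by_cases hY : Q Y *ᵥ v = 0
    · refine ⟨v, hv, hHv, fun Z hZ => ?_⟩
      rcases Finset.mem_insert.1 hZ with rfl | hZ
      · exact Or.inr hY
      · exact hT Z hZ
    -- Projecting by `Q Y` keeps the energy and the eigenvalues already fixed, because everything
    -- commutes.
    · refine ⟨Q Y *ᵥ v, hY, ?_, fun Z hZ => ?_⟩
      · have hc : Commute (hamiltonian Q) (Q Y) := Commute.sum_left _ _ _ fun Z _ => hQ.commute Z Y
        rw [Matrix.mulVec_mulVec, hc.eq, ← Matrix.mulVec_mulVec, hHv, Matrix.mulVec_smul]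
      · rcases Finset.mem_insert.1 hZ with rfl | hZ
        · exact Or.inl (by rw [Matrix.mulVec_mulVec, hQ.idempotent])
        · rw [Matrix.mulVec_mulVec, hQ.commute Z Y, ← Matrix.mulVec_mulVec]
          rcases hT Z hZ with h | h
          · exact Or.inl (by rw [h])
          · exact Or.inr (by rw [h, Matrix.mulVec_zero])

end GroundState

/-! ### Assembling the circuit -/

section Circuit

lemma isLayer_of_list {L : ℕ} {α κ : Type*} [Fintype α] [DecidableEq α] {R : ℕ} (l : List κ)
    (hl : l.Nodup) (X : κ → Finset (Site L)) (U : κ → Op (Site L) α)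
    (hU : ∀ k, U k ∈ Matrix.unitaryGroup (Site L → α) ℂ) (hX : ∀ k, SupportedOn (X k) (U k))
    (hR : ∀ k, ∀ s ∈ X k, ∀ t ∈ X k, dist (Site.pos s) (Site.pos t) ≤ R)
    (hd : ∀ k ∈ l, ∀ k' ∈ l, k ≠ k' → Disjoint (X k) (X k')) : IsLayer R (l.map U).prod := by
  refine ⟨l.map fun k => (X k, U k), ?_, ?_, ?_⟩
  · intro g hg
    obtain ⟨k, -, rfl⟩ := List.mem_map.1 hg
    exact ⟨hX k, hU k, hR k⟩
  · rw [List.pairwise_map]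
    exact List.Pairwise.imp_of_mem (fun hk hk' h => hd _ hk _ hk' h) hl
  · rw [List.map_map]
    rfl

lemma IsLayer.mem_unitaryGroup {L : ℕ} {α : Type*} [Fintype α] [DecidableEq α] {R : ℕ}
    {U : Op (Site L) α} (hU : IsLayer R U) : U ∈ Matrix.unitaryGroup (Site L → α) ℂ := by
  obtain ⟨gates, h, -, rfl⟩ := hU
  refine Submonoid.list_prod_mem _ fun W hW => ?_
  obtain ⟨g, hg, rfl⟩ := List.mem_map.1 hW
  exact (h g hg).2.1

lemma IsLocalCircuit.mem_unitaryGroup {L : ℕ} {α : Type*} [Fintype α] [DecidableEq α] {k R : ℕ}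
    {U : Op (Site L) α} (hU : IsLocalCircuit k R U) : U ∈ Matrix.unitaryGroup (Site L → α) ℂ := by
  obtain ⟨layers, -, h, rfl⟩ := hU
  exact Submonoid.list_prod_mem _ fun W hW => (h W hW).mem_unitaryGroup

variable {L D : ℕ}

lemma tensorVec_single (σ τ : Site L → Fin D) :
    tensorVec (Pi.single σ 1) (Pi.single τ 1) = Pi.single (fun s => (σ s, τ s)) 1 := by
  ext ρ
  simp only [tensorVec, Pi.single_apply, ← ite_and, mul_ite, mul_one, mul_zero]
  congr 1
  simp only [funext_iff, Prod.ext_iff, eq_iff_iff]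
  exact ⟨fun h s => ⟨h.2 s, h.1 s⟩, fun h => ⟨fun s => (h s).2, fun s => (h s).1⟩⟩

lemma isProductState_single (σ τ : Site L → Fin D) :
    IsProductState (Pi.single (fun s => (σ s, τ s)) 1) := by
  refine ⟨fun s => Pi.single (σ s) 1, fun s => Pi.single (τ s) 1, by simp, by simp, ?_⟩
  ext ρ
  rw [Pi.single_apply]
  split_ifs with h
  · simp [h]
  · obtain ⟨s, hs⟩ : ∃ s, ρ s ≠ (σ s, τ s) := by
      by_contra! h'
      exact h (funext h')
    refine (Finset.prod_eq_zero (Finset.mem_univ s) ?_).symm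
    by_contra h0
    simp only [Pi.single_apply, mul_ite, mul_one, mul_zero, ite_eq_right_iff, one_ne_zero,
      imp_false, not_not, Classical.not_imp] at h0
    exact hs (Prod.ext h0.2 h0.1)

lemma IsProductState.norm_eq_one {φ : (Site L → Fin D × Fin D) → ℂ} (hφ : IsProductState φ) :
    star φ ⬝ᵥ φ = 1 := by
  obtain ⟨p, q, hp, hq, rfl⟩ := hφ
  have h : ∀ s, ∑ x : Fin D × Fin D, star (p s x.1 * q s x.2) * (p s x.1 * q s x.2) = 1 := by
    intro s
    have h1 := hp s
    have h2 := hq s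
    simp only [dotProduct, Pi.star_apply] at h1 h2
    rw [Fintype.sum_prod_type, ← one_mul (1 : ℂ)]
    nth_rw 1 [← h1]
    rw [← h2, Finset.sum_mul]
    refine Finset.sum_congr rfl fun x _ => ?_
    rw [Finset.mul_sum]
    refine Finset.sum_congr rfl fun y _ => ?_
    rw [star_mul']
    ring
  simp only [dotProduct, Pi.star_apply, star_prod, ← Finset.prod_mul_distrib]
  have h' := Finset.prod_univ_sum (fun _ : Site L => (Finset.univ : Finset (Fin D × Fin D)))
    fun s x => star (p s x.1 * q s x.2) * (p s x.1 * q s x.2)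
  rw [Fintype.piFinset_univ, Finset.prod_congr rfl fun s _ => h s, Finset.prod_const_one] at h'
  exact h'.symm

lemma IsTrivialState.norm_eq_one {k R : ℕ} {ψ : (Site L → Fin D × Fin D) → ℂ}
    (hψ : IsTrivialState k R ψ) : star ψ ⬝ᵥ ψ = 1 := by
  obtain ⟨U, φ, hU, hφ, rfl⟩ := hψ
  have h : Uᴴ * U = 1 := Matrix.mem_unitaryGroup_iff'.1 hU.mem_unitaryGroup
  rw [Matrix.star_mulVec, ← Matrix.dotProduct_mulVec, Matrix.mulVec_mulVec, h, Matrix.one_mulVec,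
    hφ.norm_eq_one]

/-- The colour of a cell: its coordinates modulo three. -/
def cellColor {M N : ℕ} (i : Fin M × Fin N) : Fin 3 × Fin 3 :=
  (⟨i.1.val % 3, Nat.mod_lt _ (by omega)⟩, ⟨i.2.val % 3, Nat.mod_lt _ (by omega)⟩)

/-- A state prepared by a circuit whose depth and range are bounded in terms of the size of the holes
that is fixed by commuting projections with a common fixed vector, each of which is a term of the
Hamiltonian or the complement of one. -/
lemma exists_trivial_fixed [NeZero D] {Q q : Plaquette L → Op (Site L) (Fin D)}
    (hQ : IsCommutingProjectors Q) (hq : ∀ Z, q Z = Q Z ∨ q Z = 1 - Q Z) {v : (Site L → Fin D) → ℂ}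
    (hv : v ≠ 0) (hqv : ∀ Z, q Z *ᵥ v = v) {m n C : ℕ} {S : Fin m × Fin n → Finset (Site L)}
    (hS : IsHoles S) (hC : FormSquareLattice C S) (hB : ∀ i, BoundaryFactors Q (S i)) :
    ∃ ψ : (Site L → Fin D × Fin D) → ℂ, IsTrivialState 11 (68 * C) ψ ∧
      ∀ Z, withAncilla (q Z) *ᵥ ψ = ψ := by
  classical
  have hQp : ∀ Z, IsStarProjection (Q Z) := fun Z => ⟨hQ.idempotent Z, hQ.hermitian Z⟩
  have hqp : ∀ Z, IsStarProjection (q Z) := fun Z => by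
    rcases hq Z with h | h <;> rw [h]
    · exact hQp Z
    · exact (hQp Z).one_sub
  have hqc : ∀ Z {X : Op (Site L) (Fin D)}, Commute (Q Z) X → Commute (q Z) X := fun Z X hX => by
    rcases hq Z with h | h <;> rw [h]
    · exact hX
    · exact (Commute.one_left X).sub_left hX
  have hqq : ∀ Y Z, Commute (q Y) (q Z) := fun Y Z =>
    hqc Y (hqc Z (hQ.commute Z Y)).symm
  have hqA : ∀ (A : Subalgebra ℂ (Op (Site L) (Fin D))) Z, Q Z ∈ A → q Z ∈ A := fun A Z hZ => by
    rcases hq Z with h | h <;> rw [h]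
    · exact hZ
    · exact A.sub_mem A.one_mem hZ
  have hqS : ∀ Z, SupportedOn (Plaquette.sites Z) (q Z) := fun Z =>
    mem_supportAlgebra.1 (hqA _ Z (mem_supportAlgebra.2 (hQ.supported Z)))
  obtain ⟨J, cell, hcell, hdist⟩ := exists_cells hS hC
  obtain ⟨_, -, _, -, -, -, hSd, -, -⟩ := hC
  choose b w hsub hcol hnear using fun Z : {Z : Plaquette L // ∀ i ∈ J, ¬ Plaquette.sites Z ⊆ S i} =>
    hcell Z.1 Z.2
  have hfam : IsTwoCellFamily (fun Z : {Z : Plaquette L // ∀ i ∈ J, ¬ Plaquette.sites Z ⊆ S i} =>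
      q Z.1) cell IsWhite b w :=
    ⟨fun Z => hqp Z, fun Y Z => hqq Y Z, fun Z => (hqS Z).mono (hsub Z), hcol⟩
  obtain ⟨σ, G, U, hG, hU, hqUG⟩ := hfam.exists_circuit hv fun Z => hqv Z
  have hregion : ∀ j, ∀ s ∈ cellRegion cell b w j, CellsWithin 1 (cell s) j := by
    intro j s hs
    rcases (Finset.mem_filter.1 hs).2 with h | ⟨Z, h1, h2⟩
    · rw [h]
      simp [CellsWithin]
    · rw [← h1, h2]
      exact hnear Z
  have hr : ∀ i : J, ∃ r ∈ Algebra.adjoin ℂ {O | ∃ Z, Plaquette.sites Z ⊆ S i ∧ O = Q Z},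
      IsStarProjection r ∧ r ≠ 0 ∧ ∀ Z, Plaquette.sites Z ⊆ S i → q Z * r = r := by
    intro i
    obtain ⟨r, hrA, hr, hqr, hrv⟩ := exists_joint_projection
      (Finset.univ.filter fun Z : Plaquette L => Plaquette.sites Z ⊆ S i) q (fun Z _ => hqp Z)
      fun Y _ Z _ => hqq Y Z
    refine ⟨r, Algebra.adjoin_le ?_ hrA, hr, ?_, fun Z hZ => hqr Z (by simp [hZ])⟩
    · rintro _ ⟨Z, hZ, rfl⟩
      exact hqA _ Z (Algebra.subset_adjoin ⟨Z, (Finset.mem_filter.1 hZ).2, rfl⟩)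
    · rintro rfl
      exact hv (by rw [← hrv v fun Z _ => hqv Z, Matrix.zero_mulVec])
  choose r hrA hr hr0 hqr using hr
  have hrS : ∀ i : J, SupportedOn (S i) (r i) := by
    intro i
    refine mem_supportAlgebra.1 (Algebra.adjoin_le ?_ (hrA i))
    rintro _ ⟨Z, hZ, rfl⟩
    exact mem_supportAlgebra.2 ((hQ.supported Z).mono hZ)
  choose τ' T hTU hTS hTc hTr using fun i : J => exists_hole_gate hQ (hB i) (hr i) (hr0 i) (hrA i)
  have hSJ : ∀ i j : J, i ≠ j → Disjoint (S i) (S j) := fun i j h =>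
    hS.disjoint i j fun h' => h (Subtype.ext h')
  -- The holes are disjoint, so the ancilla states they require combine into one basis state; other
  -- ancillas are set to 0.
  obtain ⟨τ, hτ⟩ : ∃ τ : Site L → Fin D, ∀ i : J, (fun x : S i => τ x) = τ' i := by
    refine ⟨fun s => if h : ∃ i : J, s ∈ S i then τ' h.choose ⟨s, h.choose_spec⟩ else 0, fun i => ?_⟩
    funext x
    have hx : ∃ i : J, x.1 ∈ S i := ⟨i, x.2⟩
    have key : ∀ (i' : J) (h' : x.1 ∈ S i'), τ' i' ⟨x.1, h'⟩ = τ' i x := by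
      intro i' h'
      have : i' = i := by
        by_contra hne
        exact Finset.disjoint_left.1 (hSJ i' i hne) h' x.2
      subst this
      rfl
    simp only [dif_pos hx]
    exact key _ _
  set l := (Finset.univ : Finset (Fin (m + 2) × Fin (n + 2))).toList with hl
  have hlN : l.Nodup := Finset.nodup_toList _
  have hlm : ∀ i, i ∈ l := fun i => by simp [hl]
  set colors := (Finset.univ : Finset (Fin 3 × Fin 3)).toList with hcolors
  -- The rotations commute, so they may be ordered by colour. Regions reach at most one cell from
  -- their owner, so owners congruent modulo 3 in both coordinates have disjoint regions.
  set l' := colors.flatMap fun c => l.filter fun i => cellColor i = c with hl'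
  have hlN' : l'.Nodup := by
    rw [hl', List.nodup_flatMap]
    refine ⟨fun c _ => hlN.filter _, List.Pairwise.imp (fun {c c'} hcc => ?_)
      (Finset.nodup_toList (Finset.univ : Finset (Fin 3 × Fin 3)))⟩
    intro i hi hi'
    simp only [List.mem_filter, decide_eq_true_eq] at hi hi'
    exact hcc (hi.2.symm.trans hi'.2)
  have hlm' : ∀ i, i ∈ l' := fun i => by
    rw [hl', List.mem_flatMap]
    exact ⟨cellColor i, by simp [hcolors], by simp [hlm]⟩
  set lJ := (Finset.univ : Finset J).toList with hlJ
  have hlJN : lJ.Nodup := Finset.nodup_toList _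
  set V := (l'.map U).prod * (l.map G).prod with hV
  set φ := tensorVec (Pi.single σ 1) (Pi.single τ (1 : ℂ)) with hφ
  set Φ := realHom L D V *ᵥ φ with hΦ
  have hqΦ : ∀ Z, (∀ i ∈ J, ¬ Plaquette.sites Z ⊆ S i) → realHom L D (q Z) *ᵥ Φ = Φ := by
    intro Z hZ
    rw [hΦ, hφ, realHom_mulVec_tensorVec, realHom_mulVec_tensorVec]
    exact congrArg (fun x => tensorVec x _) (hqUG l l' hlN hlm hlN' hlm' ⟨Z, hZ⟩)
  have haΦ : ∀ i : J, ancillaHom L D (unitOn (S i) (τ' i) (τ' i)) *ᵥ Φ = Φ := by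
    intro i
    rw [hΦ, hφ, realHom_mulVec_tensorVec, ancillaHom_mulVec_tensorVec, ← hτ i,
      unitOn_mulVec_single]
  refine ⟨(lJ.map T).prod *ᵥ Φ, ⟨(lJ.map T).prod * realHom L D V, φ,
    ⟨(lJ.map T).prod :: ((colors.map fun c =>
      ((l.filter fun i => cellColor i = c).map fun i => realHom L D (U i)).prod) ++
      [(l.map fun i => realHom L D (G i)).prod]), ?_, ?_, ?_⟩, ?_, ?_⟩, fun Z => ?_⟩
  -- Depth 11: one layer of hole gates, nine colours of rotations, one layer of gates on cells.
  · simp [hcolors]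
  · intro W hW
    rw [List.mem_cons, List.mem_append, List.mem_singleton] at hW
    rcases hW with rfl | hW | rfl
    · refine isLayer_of_list lJ hlJN (fun i => S i) T hTU hTS (fun i s hs t ht => ?_)
        fun i _ j _ hij => hSJ i j hij
      refine (hSd i s hs t ht).trans ?_
      push_cast
      linarith [(Nat.cast_nonneg C : (0 : ℝ) ≤ C)]
    · obtain ⟨c, -, rfl⟩ := List.mem_map.1 hW
      refine isLayer_of_list _ (hlN.filter _) (cellRegion cell b w) _
        (fun j => realHom_mem_unitaryGroup (hU j).1) (fun j => supportedOn_realHom (hU j).2)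
        (fun j s hs t ht => hdist s t ?_) fun i hi j hj hij => ?_
      · have h1 := hregion j s hs
        have h2 := hregion j t ht
        simp only [CellsWithin] at *
        omega
      · simp only [List.mem_filter, decide_eq_true_eq] at hi hj
        rw [Finset.disjoint_left]
        intro s hs ht
        have h1 := hregion i s hs
        have h2 := hregion j s ht
        have h3 := hi.2.trans hj.2.symm
        simp only [cellColor, Prod.mk.injEq, Fin.mk.injEq] at h3
        simp only [CellsWithin] at h1 h2
        exact hij (Prod.ext (Fin.ext (by omega)) (Fin.ext (by omega)))
    · refine isLayer_of_list l hlN (cellSites cell) _ (fun j => realHom_mem_unitaryGroup (hG j).1)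
        (fun j => supportedOn_realHom (hG j).2) (fun j s hs t ht => hdist s t ?_)
        fun i _ j _ hij => disjoint_cellSites cell hij
      rw [mem_cellSites.1 hs, mem_cellSites.1 ht]
      simp [CellsWithin]
  · rw [List.prod_cons, List.prod_append, List.prod_singleton, hV, map_mul, map_list_prod,
      map_list_prod, List.map_map, List.map_map, hl', List.map_flatMap,
      List.flatMap_def, List.prod_flatten, List.map_map]
    rfl
  · rw [hφ, tensorVec_single]
    exact isProductState_single σ τ
  · rw [hΦ, Matrix.mulVec_mulVec]
  · rw [← realHom_apply]
    -- A term inside a kept hole is satisfied by that hole's gate. Any other term was satisfied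
    -- before and commutes with every hole gate.
    by_cases hZ : ∃ i ∈ J, Plaquette.sites Z ⊆ S i
    · obtain ⟨i, hiJ, hZi⟩ := hZ
      obtain ⟨R, hR, hRc⟩ := List.exists_prod_map_eq_mul T
        (fun i j hij => (hTS i).commute (hSJ i j hij) (hTS j)) hlJN
        (i := ⟨i, hiJ⟩) (by simp [hlJ])
      have hrR : Commute (realHom L D (r ⟨i, hiJ⟩)) R := hRc _ fun j hj =>
        (supportedOn_realHom (hrS _)).commute (hSJ _ _ hj.symm) (hTS j)
      have hrΨ : realHom L D (r ⟨i, hiJ⟩) *ᵥ ((lJ.map T).prod *ᵥ Φ) = (lJ.map T).prod *ᵥ Φ := by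
        rw [hR, ← Matrix.mulVec_mulVec, Matrix.mulVec_mulVec, hrR.eq, ← Matrix.mulVec_mulVec,
          realHom_apply, hTr _ Φ (haΦ _)]
      rw [← hrΨ, Matrix.mulVec_mulVec, ← map_mul, hqr ⟨i, hiJ⟩ Z hZi]
    · push Not at hZ
      have hc : Commute (realHom L D (q Z)) (lJ.map T).prod := by
        refine Commute.list_prod_right _ _ fun x hx => ?_
        obtain ⟨i, -, rfl⟩ := List.mem_map.1 hx
        have hQT : Commute (realHom L D (Q Z)) (T i) := hTc i Z (hZ i i.2)
        rcases hq Z with h | h <;> rw [h]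
        · exact hQT
        · rw [map_sub, map_one]
          exact (Commute.one_left _).sub_left hQT
      rw [Matrix.mulVec_mulVec, hc.eq, ← Matrix.mulVec_mulVec, hqΦ Z hZ]

end Circuit

end

/-! ### The ground state -/

theorem theorem2 (C : ℕ) :
    ∃ depth range : ℕ, ∀ (L D : ℕ), 0 < D →
      ∀ Q : Plaquette L → Op (Site L) (Fin D), IsCommutingProjectors Q →
      ∀ (m n : ℕ) (S : Fin m × Fin n → Finset (Site L)), IsHoles S → FormSquareLattice C S →
      (∀ i, BoundaryFactors Q (S i)) →
      ∃ ψ : (Site L → Fin D × Fin D) → ℂ,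
        IsTrivialState depth range ψ ∧
        IsGroundState (withAncilla (hamiltonian Q)) ψ ∧
        ((∃ v : (Site L → Fin D) → ℂ, v ≠ 0 ∧ hamiltonian Q *ᵥ v = 0) →
          withAncilla (hamiltonian Q) *ᵥ ψ = 0) := by
  classical
  refine ⟨11, 68 * C, fun L D hD Q hQ m n S hS hC hB => ?_⟩
  have : NeZero D := ⟨hD.ne'⟩
  obtain ⟨l, v, B, hv, hHv, hQv, hHB⟩ := hQ.exists_joint_eigenvector
  obtain ⟨ψ, hψ, hqψ⟩ := exists_trivial_fixed
    (q := fun Z => if Q Z *ᵥ v = v then Q Z else 1 - Q Z) hQ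
    (fun Z => by split_ifs <;> simp) hv
    (fun Z => by
      split_ifs with h
      · exact h
      · rw [Matrix.sub_mulVec, (hQv Z).resolve_left h, Matrix.one_mulVec, sub_zero]) hS hC hB
  have hQψ : ∀ Z, realHom L D (Q Z) *ᵥ ψ = (if Q Z *ᵥ v = v then (1 : ℂ) else 0) • ψ := by
    intro Z
    have h := hqψ Z
    rw [← realHom_apply] at h
    split_ifs at h ⊢ with hZ
    · rw [h, one_smul]
    · rw [map_sub, map_one, Matrix.sub_mulVec, Matrix.one_mulVec, sub_eq_self] at h
      rw [h, zero_smul]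
  have hQv' : ∀ Z, Q Z *ᵥ v = (if Q Z *ᵥ v = v then (1 : ℂ) else 0) • v := by
    intro Z
    split_ifs with hZ
    · rw [one_smul]
      exact hZ
    · rw [zero_smul]
      exact (hQv Z).resolve_left hZ
  set k : ℕ := (Finset.univ.filter fun Z => Q Z *ᵥ v = v).card with hk
  -- The least energy is the number of terms that `v` violates, and ψ violates the same ones. In
  -- particular it is nonnegative, which settles the zero-energy case.
  have hsum : ∑ Z, (if Q Z *ᵥ v = v then (1 : ℂ) else 0) = k := by simp [hk]
  have hlk : (l : ℂ) = k := by
    have h1 : hamiltonian Q *ᵥ v = (k : ℂ) • v := by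
      rw [hamiltonian, Matrix.sum_mulVec, ← hsum, Finset.sum_smul]
      exact Finset.sum_congr rfl fun Z _ => hQv' Z
    rw [hHv] at h1
    exact smul_left_injective ℂ hv h1
  have hHψ : withAncilla (hamiltonian Q) *ᵥ ψ = (l : ℂ) • ψ := by
    rw [← realHom_apply, hamiltonian, map_sum, Matrix.sum_mulVec, hlk, ← hsum, Finset.sum_smul]
    exact Finset.sum_congr rfl fun Z _ => hQψ Z
  have hψ1 := hψ.norm_eq_one
  have hnonneg : ∀ {κ : Type} [Fintype κ] (x : κ → ℂ), 0 ≤ (star x ⬝ᵥ x).re := by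
    intro κ _ x
    open scoped ComplexOrder in
    exact (Complex.le_def.1 (dotProduct_star_self_nonneg x)).1
  refine ⟨ψ, hψ, ⟨hψ1, fun φ hφ => ?_⟩, fun ⟨x, hx, hHx⟩ => ?_⟩
  · rw [hHψ, dotProduct_smul, hψ1, hHB, ← realHom_apply, map_add, map_smul, map_one, map_mul,
      map_star, Matrix.add_mulVec, Matrix.smul_mulVec, Matrix.one_mulVec, dotProduct_add,
      dotProduct_smul, hφ, Complex.add_re, ← Matrix.mulVec_mulVec, Matrix.dotProduct_mulVec]
    have h : star φ ᵥ* star (realHom L D B) = star (realHom L D B *ᵥ φ) :=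
      (Matrix.star_mulVec _ _).symm
    rw [h]
    exact le_add_of_nonneg_right (hnonneg _)
  · have hl0 : l ≤ 0 := by
      have h1 : star x ⬝ᵥ (hamiltonian Q *ᵥ x) =
          (l : ℂ) * (star x ⬝ᵥ x) + star (B *ᵥ x) ⬝ᵥ (B *ᵥ x) := by
        have h : star x ᵥ* star B = star (B *ᵥ x) := (Matrix.star_mulVec _ _).symm
        rw [hHB, Matrix.add_mulVec, Matrix.smul_mulVec, Matrix.one_mulVec, dotProduct_add,
          dotProduct_smul, smul_eq_mul, ← Matrix.mulVec_mulVec, Matrix.dotProduct_mulVec, h]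
      rw [hHx, dotProduct_zero] at h1
      have h2 := congrArg Complex.re h1
      rw [Complex.add_re, Complex.re_ofReal_mul, Complex.zero_re] at h2
      have h3 : 0 < (star x ⬝ᵥ x).re := by
        open scoped ComplexOrder in
        exact (Complex.lt_def.1 (Matrix.dotProduct_star_self_pos_iff.2 hx)).1
      have h4 := hnonneg (B *ᵥ x)
      by_contra! hl
      linarith [mul_pos hl h3]
    have : l = k := Complex.ofReal_injective (by rw [hlk, Complex.ofReal_natCast])
    have : l = 0 := le_antisymm hl0 (this ▸ Nat.cast_nonneg k)
    rw [hHψ, this, Complex.ofReal_zero, zero_smul]
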